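/- Let $\mathbb{K}$ be a field of characteristic zero equipped with a non-trivial absolute value $|\cdot|$ (archimedean or not, not necessarily complete). Write $\mathbb{K}[[x]]$ for the ring of formal power series in $x=(x_1,\dots,x_n)$, with maximal ideal $\mathfrak{m}_x=(x_1,\dots,x_n)$, and call a power series $\sum_\alpha a_\alpha x^\alpha$ convergent if $\sum_\alpha |a_\alpha|\, r^{|\alpha|}<\infty$ for some real $r>0$. Let $m,n,N$ be arbitrary non-negative integers and let $f(x,y)=(f_1(x,y),\dots,f_m(x,y))$ be convergent power series in the variables $x=(x_1,\dots,x_n)$ and $y=(y_1,\dots,y_N)$ with coefficients in $\mathbb{K}$. **The Artin Approximation Theorem.** Suppose that there exist formal power series $\bar y(x)=(\bar y_1(x),\dots,\bar y_N(x))\in\mathbb{K}[[x]]^N$ without constant term such that $f(x,\bar y(x))=0$. Then for every integer $c>0$ there exist convergent power series $y(x)=(y_1(x),\dots,y_N(x))$ without constant term such that $$f(x,y(x))=0\quad\text{and}\quad y_\nu(x)-\bar y_\nu(x)\in\mathfrak{m}_x^{\,c}\quad\text{for }\nu=1,\dots,N .$$ -/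

import Mathlib

/-- A formal power series `f = ∑ a_d x^d` in the variables `σ` over a field with an absolute value is
convergent if it converges absolutely on some polydisc around the origin:
`∑ ‖a_d‖ r ^ |d| < ∞` for some `r > 0`, where `|d| = ∑ i, d i` is the total degree. -/
def MvPowerSeries.IsConvergent {σ K : Type*} [NormedField K] (f : MvPowerSeries σ K) : Prop :=
  ∃ r : ℝ, 0 < r ∧ Summable fun d : σ →₀ ℕ => ‖MvPowerSeries.coeff d f‖ * r ^ d.degree

/-- The power series `f(x, y(x))` obtained from `f(x, y)` (with `x` and `y` the variables indexed by
the left and right summand) by substituting for `y` a finite family of power series in `x`.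
It has its usual meaning when the series `y j` have no constant term. -/
noncomputable def MvPowerSeries.substRight {n N : ℕ} {K : Type*} [Field K]
    (f : MvPowerSeries (Fin n ⊕ Fin N) K) (y : Fin N → MvPowerSeries (Fin n) K) :
    MvPowerSeries (Fin n) K :=
  MvPowerSeries.subst
    (Sum.elim (fun i : Fin n => (MvPowerSeries.X i : MvPowerSeries (Fin n) K)) y) f

/-! The statement is strengthened to `Approximable`: the convergent `y` is to satisfy every
convergent relation of `ybar`, not only the given equations. In this form it is proved by induction
on the number of variables `x` (`approximable_fin`).

For the inductive step, choose convergent relations `g` of `ybar` with a Jacobian minor `δ` in the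
variables `y` that is nonzero at `ybar` and has maximal size (`exists_maximal_minor`). Two things
remain.

(1) Solve `g = 0` by a convergent `y` near `ybar` (`exists_solution_of_minor`,
`exists_solution_of_regular`). After a linear change of coordinates, `δ(x, ybar)` is a unit times a
Weierstrass polynomial `a` in one variable `t`. Reduced modulo `t ^ c * a ^ 2`, `ybar` becomes a
tuple of polynomials in `t`; their coefficients and those of `a` are finitely many formal series in
one variable fewer. Weierstrass division with indeterminate coefficients turns "`t ^ c * a ^ 2`
divides `g(y)`" and "`a` divides `δ(y)`" into convergent relations of these coefficients. Induction
supplies convergent coefficients, and Tougeron's theorem (`exists_tougeron`) corrects the resulting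
approximate solution.

(2) If `y` is close enough to `ybar`, then `g(y) = 0` implies all convergent relations `f` of `ybar`
(`subst_eq_zero_of_close`). Along a general line, `ybar` and `y` are joined inside `g = 0` by a
point over `K[[t, s]]`. There `δ * ∂f/∂s` is a combination of larger minors, which by maximality are
again relations of `ybar`; induction on the order in `s` makes `f` vanish.

Convergence is handled uniformly: series are fixed points of maps that contract for an order
filtration, hence exist formally, and they converge because the map preserves a ball of a weighted
`ℓ¹` norm, which is closed under coefficientwise limits. Completeness of `K` plays no role, and
archimedean and non-archimedean absolute values are treated alike. -/

open scoped ENNReal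

namespace MvPowerSeries

/-! ### Weighted `ℓ¹` norms and the ring of convergent power series -/

section Norm

variable {σ τ : Type*} {K : Type*} [NormedField K]

/-- The weight `∏ ρ i ^ d i` of the monomial `x ^ d`. -/
noncomputable def wt (ρ : σ → ℝ≥0∞) (d : σ →₀ ℕ) : ℝ≥0∞ := d.prod fun i k => ρ i ^ k

/-- The `ℓ¹`-norm of a power series on the polydisc of polyradius `ρ`. -/
noncomputable def wnorm (ρ : σ → ℝ≥0∞) (f : MvPowerSeries σ K) : ℝ≥0∞ :=
  ∑' d, ‖coeff d f‖ₑ * wt ρ d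

@[simp] lemma wt_zero (ρ : σ → ℝ≥0∞) : wt ρ 0 = 1 := by simp [wt]

lemma wt_add (ρ : σ → ℝ≥0∞) (a b : σ →₀ ℕ) : wt ρ (a + b) = wt ρ a * wt ρ b := by
  classical
  exact Finsupp.prod_add_index' (by simp) (by simp [pow_add])

@[simp] lemma wt_single (ρ : σ → ℝ≥0∞) (i : σ) (k : ℕ) : wt ρ (Finsupp.single i k) = ρ i ^ k := by
  simp [wt]

lemma wt_mono {ρ ρ' : σ → ℝ≥0∞} (h : ρ ≤ ρ') (d : σ →₀ ℕ) : wt ρ d ≤ wt ρ' d :=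
  Finset.prod_le_prod' fun i _ => pow_le_pow_left' (h i) _

lemma wt_const (r : ℝ≥0∞) (d : σ →₀ ℕ) : wt (fun _ => r) d = r ^ d.degree := by
  simp [wt, Finsupp.prod, Finset.prod_pow_eq_pow_sum, Finsupp.degree_apply]

lemma wt_const_mul (t : ℝ≥0∞) (ρ : σ → ℝ≥0∞) (d : σ →₀ ℕ) :
    wt (fun i => t * ρ i) d = t ^ d.degree * wt ρ d := by
  rw [← wt_const]
  simp [wt, Finsupp.prod, mul_pow, Finset.prod_mul_distrib]

lemma wnorm_mono {ρ ρ' : σ → ℝ≥0∞} (h : ρ ≤ ρ') (f : MvPowerSeries σ K) :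
    wnorm ρ f ≤ wnorm ρ' f :=
  ENNReal.tsum_le_tsum fun d => by gcongr; exact wt_mono h d

lemma wnorm_add_le (ρ : σ → ℝ≥0∞) (f g : MvPowerSeries σ K) :
    wnorm ρ (f + g) ≤ wnorm ρ f + wnorm ρ g := by
  rw [wnorm, wnorm, wnorm, ← ENNReal.tsum_add]
  refine ENNReal.tsum_le_tsum fun d => ?_
  rw [← add_mul, map_add]
  gcongr
  exact enorm_add_le _ _

@[simp] lemma wnorm_neg (ρ : σ → ℝ≥0∞) (f : MvPowerSeries σ K) : wnorm ρ (-f) = wnorm ρ f := by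
  simp [wnorm]

lemma wnorm_sub_le (ρ : σ → ℝ≥0∞) (f g : MvPowerSeries σ K) :
    wnorm ρ (f - g) ≤ wnorm ρ f + wnorm ρ g := by
  rw [sub_eq_add_neg, ← wnorm_neg ρ g]
  exact wnorm_add_le _ _ _

@[simp] lemma wnorm_zero (ρ : σ → ℝ≥0∞) : wnorm ρ (0 : MvPowerSeries σ K) = 0 := by
  simp [wnorm]

lemma wnorm_monomial (ρ : σ → ℝ≥0∞) (d : σ →₀ ℕ) (a : K) :
    wnorm ρ (monomial d a) = ‖a‖ₑ * wt ρ d := by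
  classical
  rw [wnorm, tsum_eq_single d]
  · simp
  · intro b hb
    simp [coeff_monomial_ne hb]

@[simp] lemma wnorm_X (ρ : σ → ℝ≥0∞) (i : σ) : wnorm ρ (X i : MvPowerSeries σ K) = ρ i := by
  simp [X, wnorm_monomial]

@[simp] lemma wnorm_C (ρ : σ → ℝ≥0∞) (a : K) : wnorm ρ (C a : MvPowerSeries σ K) = ‖a‖ₑ := by
  rw [← monomial_zero_eq_C_apply, wnorm_monomial]; simp

@[simp] lemma wnorm_one (ρ : σ → ℝ≥0∞) : wnorm ρ (1 : MvPowerSeries σ K) = 1 := by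
  rw [← map_one C, wnorm_C]; simp

lemma wnorm_mul_le (ρ : σ → ℝ≥0∞) (f g : MvPowerSeries σ K) :
    wnorm ρ (f * g) ≤ wnorm ρ f * wnorm ρ g := by
  classical
  have h : wnorm ρ f * wnorm ρ g = ∑' d : σ →₀ ℕ, ∑ p ∈ Finset.HasAntidiagonal.antidiagonal d,
      (‖coeff p.1 f‖ₑ * wt ρ p.1) * (‖coeff p.2 g‖ₑ * wt ρ p.2) := by
    rw [wnorm, wnorm, ← ENNReal.tsum_mul_right]
    simp_rw [← ENNReal.tsum_mul_left]
    rw [← ENNReal.tsum_prod, ← Finset.HasAntidiagonal.sigmaAntidiagonalEquivProd.tsum_eq, ENNReal.tsum_sigma']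
    refine tsum_congr fun d => ?_
    rw [← Finset.tsum_subtype']
    rfl
  rw [h]
  refine ENNReal.tsum_le_tsum fun d => ?_
  rw [coeff_mul]
  calc _ ≤ (∑ p ∈ Finset.HasAntidiagonal.antidiagonal d, ‖coeff p.1 f * coeff p.2 g‖ₑ) * wt ρ d := by
        gcongr; exact enorm_sum_le _ _
    _ = _ := by
        rw [Finset.sum_mul]
        refine Finset.sum_congr rfl fun p hp => ?_
        rw [← Finset.HasAntidiagonal.mem_antidiagonal.1 hp, wt_add, enorm_mul]
        ring

lemma wnorm_pow_le (ρ : σ → ℝ≥0∞) (f : MvPowerSeries σ K) (n : ℕ) :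
    wnorm ρ (f ^ n) ≤ wnorm ρ f ^ n := by
  induction n with
  | zero => simp
  | succ n ih => rw [pow_succ, pow_succ]; exact (wnorm_mul_le _ _ _).trans (by gcongr)

lemma wnorm_prod_le {ι : Type*} (ρ : σ → ℝ≥0∞) (s : Finset ι) (f : ι → MvPowerSeries σ K) :
    wnorm ρ (∏ i ∈ s, f i) ≤ ∏ i ∈ s, wnorm ρ (f i) := by
  classical
  induction s using Finset.induction_on with
  | empty => simp
  | insert i s hi ih =>
    rw [Finset.prod_insert hi, Finset.prod_insert hi]
    exact (wnorm_mul_le _ _ _).trans (by gcongr)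

/-- An infinite support makes `finsum` equal to `0`, so no finiteness hypothesis is needed. -/
lemma enorm_finsum_le {ι : Type*} (f : ι → K) : ‖∑ᶠ i, f i‖ₑ ≤ ∑' i, ‖f i‖ₑ := by
  classical
  by_cases h : (Function.support f).Finite
  · rw [finsum_eq_sum _ h]
    exact (enorm_sum_le _ _).trans (ENNReal.sum_le_tsum _)
  · rw [finsum_of_infinite_support h]; simp

/-- Expand in monomials of `a` and exchange the sums, which is free in `ℝ≥0∞`; submultiplicativity
then bounds each monomial. -/
lemma wnorm_subst_le (ρ : τ → ℝ≥0∞) {a : σ → MvPowerSeries τ K} (ha : HasSubst a)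
    (f : MvPowerSeries σ K) :
    wnorm ρ (subst a f) ≤ wnorm (fun i => wnorm ρ (a i)) f := by
  have h1 : ∀ e, ‖coeff e (subst a f)‖ₑ * wt ρ e ≤
      ∑' d : σ →₀ ℕ, ‖coeff d f‖ₑ * (‖coeff e (d.prod fun s k => a s ^ k)‖ₑ * wt ρ e) := by
    intro e
    rw [coeff_subst ha]
    calc _ ≤ (∑' d : σ →₀ ℕ, ‖coeff d f • coeff e (d.prod fun s k => a s ^ k)‖ₑ) * wt ρ e := by
          gcongr; exact enorm_finsum_le _
      _ = _ := by
          rw [← ENNReal.tsum_mul_right]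
          refine tsum_congr fun d => ?_
          rw [smul_eq_mul, enorm_mul, mul_assoc]
  calc wnorm ρ (subst a f) ≤ _ := ENNReal.tsum_le_tsum h1
    _ = ∑' d : σ →₀ ℕ, ‖coeff d f‖ₑ * wnorm ρ (d.prod fun s k => a s ^ k) := by
        rw [ENNReal.tsum_comm]
        refine tsum_congr fun d => ?_
        rw [ENNReal.tsum_mul_left]; rfl
    _ ≤ _ := by
        refine ENNReal.tsum_le_tsum fun d => ?_
        gcongr
        refine (wnorm_prod_le _ _ _).trans (Finset.prod_le_prod' fun i _ => wnorm_pow_le _ _ _)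

/-- Every nonconstant monomial gains at least one factor `t`. -/
lemma wnorm_const_mul_le {t : ℝ≥0∞} (ht : t ≤ 1) (ρ : σ → ℝ≥0∞) {f : MvPowerSeries σ K}
    (hf : constantCoeff f = 0) : wnorm (fun i => t * ρ i) f ≤ t * wnorm ρ f := by
  rw [wnorm, wnorm, ← ENNReal.tsum_mul_left]
  refine ENNReal.tsum_le_tsum fun d => ?_
  rw [wt_const_mul]
  by_cases hd : d = 0
  · subst hd; simp [hf]
  · have : d.degree ≠ 0 := by rwa [Ne, Finsupp.degree_eq_zero_iff]
    calc _ ≤ ‖coeff d f‖ₑ * (t * wt ρ d) := by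
          gcongr; exact pow_le_of_le_one zero_le ht this
      _ = _ := by ring

/-- Norm balls are closed for the order filtration: a finite partial sum sees only coefficients of
bounded weight, and these agree with those of some `v`. This stands in for completeness of `K`. -/
lemma wnorm_le_of_forall_exists (w : σ → ℕ) (ρ : σ → ℝ≥0∞) {B : ℝ≥0∞} {u : MvPowerSeries σ K}
    (h : ∀ k : ℕ, ∃ v, wnorm ρ v ≤ B ∧ (k : ℕ∞) ≤ weightedOrder w (u - v)) : wnorm ρ u ≤ B := by
  rw [wnorm, ENNReal.tsum_eq_iSup_sum]
  refine iSup_le fun s => ?_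
  obtain ⟨v, hv, hk⟩ := h (s.sup (Finsupp.weight w) + 1)
  have : ∀ d ∈ s, coeff d u = coeff d v := by
    intro d hd
    have h1 : coeff d (u - v) = 0 := by
      apply coeff_eq_zero_of_lt_weightedOrder w
      refine lt_of_lt_of_le ?_ hk
      exact_mod_cast Nat.lt_succ_of_le (Finset.le_sup (f := Finsupp.weight w) hd)
    rwa [map_sub, sub_eq_zero] at h1
  rw [Finset.sum_congr rfl fun d hd => by rw [this d hd]]
  exact (ENNReal.sum_le_tsum s).trans hv

lemma isConvergent_iff {f : MvPowerSeries σ K} :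
    f.IsConvergent ↔ ∃ r : ℝ≥0∞, r ≠ 0 ∧ wnorm (fun _ => r) f ≠ ∞ := by
  have key : ∀ r : ℝ, 0 < r → ((Summable fun d : σ →₀ ℕ => ‖coeff d f‖ * r ^ d.degree) ↔
      wnorm (fun _ => ENNReal.ofReal r) f ≠ ∞) := by
    intro r hr
    have : ∀ d : σ →₀ ℕ, ‖coeff d f‖ₑ * wt (fun _ => ENNReal.ofReal r) d =
        ENNReal.ofReal (‖coeff d f‖ * r ^ d.degree) := by
      intro d
      rw [wt_const, ENNReal.ofReal_mul (norm_nonneg _), ENNReal.ofReal_pow hr.le, ofReal_norm]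
    rw [wnorm, tsum_congr this]
    constructor
    · intro h; exact h.tsum_ofReal_ne_top
    · intro h
      have := ENNReal.summable_toReal h
      refine this.congr fun d => ?_
      rw [ENNReal.toReal_ofReal (by positivity)]
  constructor
  · rintro ⟨r, hr, h⟩
    exact ⟨ENNReal.ofReal r, by simpa using hr, (key r hr).1 h⟩
  · rintro ⟨r, hr, h⟩
    -- The radius `r` may be `∞`; cutting it off at `1` makes it a real number.
    have hm : min r 1 ≠ 0 := by simpa using hr
    have hm' : min r 1 ≠ ∞ := ne_top_of_le_ne_top ENNReal.one_ne_top (min_le_right _ _)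
    refine ⟨(min r 1).toReal, ENNReal.toReal_pos hm hm', (key _ (ENNReal.toReal_pos hm hm')).2 ?_⟩
    rw [ENNReal.ofReal_toReal hm']
    exact ne_top_of_le_ne_top h (wnorm_mono (fun _ => min_le_left _ _) f)

lemma exists_ne_zero_forall_le [Finite σ] (ρ : σ → ℝ≥0∞) (hρ : ∀ i, ρ i ≠ 0) :
    ∃ r : ℝ≥0∞, r ≠ 0 ∧ r ≠ ∞ ∧ ∀ i, r ≤ ρ i := by
  cases nonempty_fintype σ
  refine ⟨min 1 (Finset.univ.inf ρ), ?_, ?_, ?_⟩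
  · intro h
    rcases min_eq_bot.1 h with h | h
    · simp at h
    · obtain ⟨i, -, hi⟩ := (Finset.inf_eq_bot_iff (s := Finset.univ) (f := ρ)).1 h
      exact hρ i hi
  · exact ne_top_of_le_ne_top ENNReal.one_ne_top (min_le_left _ _)
  · intro i
    exact (min_le_right _ _).trans (Finset.inf_le (Finset.mem_univ i))

lemma isConvergent_of_wnorm [Finite σ] {f : MvPowerSeries σ K} {ρ : σ → ℝ≥0∞} (hρ : ∀ i, ρ i ≠ 0)
    (h : wnorm ρ f ≠ ∞) : f.IsConvergent := by
  obtain ⟨r, hr, -, hr'⟩ := exists_ne_zero_forall_le ρ hρ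
  exact isConvergent_iff.2 ⟨r, hr, ne_top_of_le_ne_top h (wnorm_mono hr' f)⟩

lemma IsConvergent.exists_radius {ι : Type*} [Finite ι] {f : ι → MvPowerSeries σ K}
    (hf : ∀ i, (f i).IsConvergent) :
    ∃ r : ℝ≥0∞, r ≠ 0 ∧ r ≠ ∞ ∧ ∀ i, wnorm (fun _ => r) (f i) ≠ ∞ := by
  choose ρ h0 h1 using fun i => isConvergent_iff.1 (hf i)
  obtain ⟨r, hr, hr', h⟩ := exists_ne_zero_forall_le ρ h0
  exact ⟨r, hr, hr', fun i => ne_top_of_le_ne_top (h1 i) (wnorm_mono (fun _ => h i) _)⟩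

/-- Convergent power series without constant term are small near the origin. -/
lemma IsConvergent.exists_wnorm_le {ι : Type*} [Finite ι] {f : ι → MvPowerSeries σ K}
    (hf : ∀ i, (f i).IsConvergent) (h0 : ∀ i, constantCoeff (f i) = 0) {ε : ℝ≥0∞} (hε : ε ≠ 0) :
    ∃ r : ℝ≥0∞, r ≠ 0 ∧ r ≠ ∞ ∧ ∀ i, wnorm (fun _ => r) (f i) ≤ ε := by
  obtain ⟨r, hr, hr', h⟩ := IsConvergent.exists_radius hf
  cases nonempty_fintype ι
  set M := ∑ i, wnorm (fun _ => r) (f i) with hM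
  have hMt : M ≠ ∞ := by simpa [hM] using h
  set t := min 1 (ε / M) with ht
  have ht0 : t ≠ 0 := by
    intro h
    rcases min_eq_bot.1 h with h | h
    · simp at h
    · rcases ENNReal.div_eq_zero_iff.1 h with h | h
      · exact hε h
      · exact hMt h
  refine ⟨t * r, mul_ne_zero ht0 hr,
    ENNReal.mul_ne_top (ne_top_of_le_ne_top ENNReal.one_ne_top (min_le_left _ _)) hr', fun i => ?_⟩
  calc _ ≤ t * wnorm (fun _ => r) (f i) := wnorm_const_mul_le (min_le_left _ _) _ (h0 i)
    _ ≤ (ε / M) * M := by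
        gcongr
        · exact min_le_right _ _
        · exact Finset.single_le_sum (f := fun i => wnorm (fun _ => r) (f i))
            (fun _ _ => zero_le) (Finset.mem_univ i)
    _ ≤ ε := by
        rw [mul_comm]; exact ENNReal.mul_div_le

lemma IsConvergent.add {f g : MvPowerSeries σ K} (hf : f.IsConvergent) (hg : g.IsConvergent) :
    (f + g).IsConvergent := by
  obtain ⟨r, hr, -, h⟩ := IsConvergent.exists_radius (ι := Bool) (f := fun b => cond b f g)
    (by rintro (_ | _) <;> assumption)
  exact isConvergent_iff.2 ⟨r, hr, ne_top_of_le_ne_top (ENNReal.add_ne_top.2 ⟨h true, h false⟩)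
    (wnorm_add_le _ _ _)⟩

lemma IsConvergent.mul {f g : MvPowerSeries σ K} (hf : f.IsConvergent) (hg : g.IsConvergent) :
    (f * g).IsConvergent := by
  obtain ⟨r, hr, -, h⟩ := IsConvergent.exists_radius (ι := Bool) (f := fun b => cond b f g)
    (by rintro (_ | _) <;> assumption)
  exact isConvergent_iff.2 ⟨r, hr, ne_top_of_le_ne_top (ENNReal.mul_ne_top (h true) (h false))
    (wnorm_mul_le _ _ _)⟩

lemma isConvergent_C (a : K) : (C a : MvPowerSeries σ K).IsConvergent :=
  isConvergent_iff.2 ⟨1, one_ne_zero, by simp⟩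

lemma isConvergent_X (i : σ) : (X i : MvPowerSeries σ K).IsConvergent :=
  isConvergent_iff.2 ⟨1, one_ne_zero, by simp⟩

variable (σ K) in
/-- The ring of convergent power series. -/
def convergent : Subring (MvPowerSeries σ K) where
  carrier := {f | f.IsConvergent}
  mul_mem' := IsConvergent.mul
  one_mem' := by simpa using isConvergent_C (σ := σ) (1 : K)
  add_mem' := IsConvergent.add
  zero_mem' := by simpa using isConvergent_C (σ := σ) (0 : K)
  neg_mem' := by
    intro f hf
    obtain ⟨r, hr, h⟩ := isConvergent_iff.1 hf
    exact isConvergent_iff.2 ⟨r, hr, by simpa using h⟩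

@[simp] lemma mem_convergent {f : MvPowerSeries σ K} : f ∈ convergent σ K ↔ f.IsConvergent :=
  Iff.rfl

lemma IsConvergent.subst [Finite σ] {a : σ → MvPowerSeries τ K} {f : MvPowerSeries σ K}
    (hf : f.IsConvergent) (ha : ∀ i, (a i).IsConvergent) (h0 : ∀ i, constantCoeff (a i) = 0) :
    (subst a f).IsConvergent := by
  obtain ⟨r, hr, h⟩ := isConvergent_iff.1 hf
  obtain ⟨s, hs, -, h'⟩ := IsConvergent.exists_wnorm_le ha h0 hr
  refine isConvergent_iff.2 ⟨s, hs, ne_top_of_le_ne_top h ?_⟩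
  exact (wnorm_subst_le _ (hasSubst_of_constantCoeff_zero h0) f).trans (wnorm_mono h' f)

lemma isConvergent_det {n : Type*} [Fintype n] [DecidableEq n] {A : Matrix n n (MvPowerSeries σ K)}
    (hA : ∀ i j, (A i j).IsConvergent) : A.det.IsConvergent := by
  rw [← mem_convergent, Matrix.det_apply]
  exact sum_mem fun p _ => zsmul_mem (prod_mem fun i _ => hA _ _) _

lemma isConvergent_adjugate {n : Type*} [Fintype n] [DecidableEq n]
    {A : Matrix n n (MvPowerSeries σ K)} (hA : ∀ i j, (A i j).IsConvergent) (i j : n) :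
    (A.adjugate i j).IsConvergent := by
  rw [Matrix.adjugate_apply]
  refine isConvergent_det fun k l => ?_
  rw [Matrix.updateRow_apply]
  split_ifs
  · rw [Pi.single_apply]
    split_ifs
    · exact one_mem (convergent σ K)
    · exact zero_mem (convergent σ K)
  · exact hA _ _

end Norm

end MvPowerSeries

namespace MvPowerSeries

/-! ### Order filtrations and formal fixed points -/

section Filtration

variable {σ τ ω : Type*} {K : Type*} [Field K]

/-- The ideal of power series of weighted order at least `k`. -/
def wIdeal (w : σ → ℕ) (k : ℕ) : Ideal (MvPowerSeries σ K) where
  carrier := {f | (k : ℕ∞) ≤ weightedOrder w f}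
  add_mem' := fun hf hg => (le_min hf hg).trans (min_weightedOrder_le_add w)
  zero_mem' := by simp
  smul_mem' := fun c f hf => by
    have : (k : ℕ∞) ≤ weightedOrder w (c * f) :=
      (le_trans hf le_add_self).trans (le_weightedOrder_mul w)
    simpa using this

lemma mem_wIdeal {w : σ → ℕ} {k : ℕ} {f : MvPowerSeries σ K} :
    f ∈ wIdeal w k ↔ (k : ℕ∞) ≤ weightedOrder w f := Iff.rfl

lemma mem_wIdeal_iff {w : σ → ℕ} {k : ℕ} {f : MvPowerSeries σ K} :
    f ∈ wIdeal w k ↔ ∀ d, Finsupp.weight w d < k → coeff d f = 0 := by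
  constructor
  · intro h d hd
    exact coeff_eq_zero_of_lt_weightedOrder w (lt_of_lt_of_le (by exact_mod_cast hd) h)
  · intro h
    exact nat_le_weightedOrder w h

lemma wIdeal_anti (w : σ → ℕ) {k l : ℕ} (h : k ≤ l) :
    (wIdeal w l : Ideal (MvPowerSeries σ K)) ≤ wIdeal w k :=
  fun _ hf => le_trans (Nat.cast_le.2 h) (mem_wIdeal.1 hf)

lemma mul_mem_wIdeal {w : σ → ℕ} {k l : ℕ} {f g : MvPowerSeries σ K} (hf : f ∈ wIdeal w k)
    (hg : g ∈ wIdeal w l) : f * g ∈ wIdeal w (k + l) := by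
  rw [mem_wIdeal] at *
  push_cast
  exact (add_le_add hf hg).trans (le_weightedOrder_mul w)

lemma eq_zero_of_forall_mem_wIdeal {w : σ → ℕ} {f : MvPowerSeries σ K}
    (h : ∀ k, f ∈ wIdeal w k) : f = 0 := by
  ext d
  exact mem_wIdeal_iff.1 (h (Finsupp.weight w d + 1)) d (Nat.lt_succ_self _)

lemma mem_wIdeal_zero (w : σ → ℕ) (f : MvPowerSeries σ K) : f ∈ wIdeal w 0 := by
  rw [mem_wIdeal]; simp

lemma mem_wIdeal_one_iff {f : MvPowerSeries σ K} :
    f ∈ wIdeal (fun _ => 1) 1 ↔ constantCoeff f = 0 := by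
  rw [mem_wIdeal_iff]
  constructor
  · intro h
    simpa using h 0 (by simp)
  · intro h d hd
    have hd' : Finsupp.weight (fun _ => 1) d = Finsupp.degree d := by
      rw [Finsupp.degree_eq_weight_one]
    rw [hd', Nat.lt_one_iff, Finsupp.degree_eq_zero_iff] at hd
    subst hd; simpa using h

/-- A map of tuples of power series that is contracting for a weighted order and preserves a
nonempty closed set has a fixed point in that set. -/
theorem exists_fixedPoint (w : σ → ℕ) (S : Set (ω → MvPowerSeries σ K))
    (Φ : (ω → MvPowerSeries σ K) → ω → MvPowerSeries σ K) {u₀ : ω → MvPowerSeries σ K}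
    (h₀ : u₀ ∈ S) (hΦ : ∀ u ∈ S, Φ u ∈ S)
    (hc : ∀ u ∈ S, ∀ v ∈ S, ∀ k, (∀ j, u j - v j ∈ wIdeal w k) →
      ∀ j, Φ u j - Φ v j ∈ wIdeal w (k + 1))
    (hS : ∀ u, (∀ k, ∃ v ∈ S, ∀ j, u j - v j ∈ wIdeal w k) → u ∈ S) :
    ∃ u ∈ S, Φ u = u := by
  set v : ℕ → ω → MvPowerSeries σ K := fun n => Φ^[n] u₀ with hv
  have hvs : ∀ n, v (n + 1) = Φ (v n) := fun n => Function.iterate_succ_apply' _ _ _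
  have hvS : ∀ n, v n ∈ S := by
    intro n
    induction n with
    | zero => exact h₀
    | succ n ih => rw [hvs]; exact hΦ _ ih
  have hstep : ∀ n j, v (n + 1) j - v n j ∈ wIdeal w n := by
    intro n
    induction n with
    | zero => exact fun j => mem_wIdeal_zero _ _
    | succ n ih =>
      intro j
      rw [hvs (n + 1), hvs n]
      exact hc _ (by rw [← hvs]; exact hvS _) _ (hvS n) n (by rw [← hvs]; exact ih) j
  have hdiff : ∀ n m j, v (n + m) j - v n j ∈ wIdeal w n := by
    intro n m j
    induction m with
    | zero => simp
    | succ m ih =>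
      have := add_mem (wIdeal_anti w (Nat.le_add_right n m) (hstep (n + m) j)) ih
      simpa [add_assoc] using this
  -- The coefficient at `d` no longer changes after iterate `weight w d + 1`. Reading the limit off
  -- in this way works even when infinitely many monomials share a weight, as for weights with value
  -- `0`.
  set u : ω → MvPowerSeries σ K :=
    fun j d => coeff d (v (Finsupp.weight w d + 1) j) with hu
  have hlim : ∀ n j, u j - v n j ∈ wIdeal w n := by
    intro n j
    rw [mem_wIdeal_iff]
    intro d hd
    obtain ⟨m, hm⟩ := Nat.exists_eq_add_of_le (Nat.succ_le_of_lt hd)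
    have h1 := mem_wIdeal_iff.1 (hdiff (Finsupp.weight w d + 1) m j) d (Nat.lt_succ_self _)
    have h2 : coeff d (u j) = coeff d (v (Finsupp.weight w d + 1) j) := rfl
    rw [map_sub, h2, hm, ← neg_sub, ← map_sub]
    rw [Nat.succ_eq_add_one, h1, neg_zero]
  have huS : u ∈ S := hS u fun k => ⟨v k, hvS k, hlim k⟩
  refine ⟨u, huS, funext fun j => sub_eq_zero.1 ?_⟩
  refine eq_zero_of_forall_mem_wIdeal (w := w) fun k => ?_
  have h1 := wIdeal_anti w (Nat.le_succ k) (hc u huS (v k) (hvS k) k (hlim k) j)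
  have h2 := wIdeal_anti w (Nat.le_succ k) (hlim (k + 1) j)
  rw [hvs] at h2
  simpa using sub_mem h1 h2

end Filtration

/-! ### Splitting off variables (Hadamard's lemma) -/

section Hadamard

variable {σ τ ω : Type*} {K : Type*}

lemma subst_subst [Field K] {υ : Type*} {a : σ → MvPowerSeries τ K} {b : τ → MvPowerSeries υ K}
    (ha : HasSubst a) (hb : HasSubst b) (f : MvPowerSeries σ K) :
    subst b (subst a f) = subst (fun i => subst b (a i)) f :=
  subst_comp_subst_apply ha hb f

lemma constantCoeff_subst_zero [Field K] {a : σ → MvPowerSeries τ K} [Finite σ]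
    (ha : ∀ i, constantCoeff (a i) = 0) (f : MvPowerSeries σ K) :
    constantCoeff (subst a f) = constantCoeff f := by
  have h0 : constantCoeff (subst a (f - C (constantCoeff f))) = 0 :=
    constantCoeff_subst_eq_zero (hasSubst_of_constantCoeff_zero ha) ha (by simp)
  have h1 : subst a (C (constantCoeff f)) = (C (constantCoeff f) : MvPowerSeries τ K) := by
    rw [subst_C]
  rw [subst_sub (hasSubst_of_constantCoeff_zero ha), map_sub, h1, sub_eq_zero] at h0
  rw [h0, constantCoeff_C]

/-- Such a `g` is dominated by a quotient of `f` by the monomial `x ^ e`; division costs at most the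
factor `(wt ρ e)⁻¹`. -/
lemma wnorm_mul_wt_le [NormedField K] (ρ : σ → ℝ≥0∞) {f g : MvPowerSeries σ K} {e : σ →₀ ℕ}
    (h : ∀ d, ‖coeff d g‖ₑ ≤ ‖coeff (d + e) f‖ₑ) : wnorm ρ g * wt ρ e ≤ wnorm ρ f := by
  rw [wnorm, ← ENNReal.tsum_mul_right]
  calc _ ≤ ∑' d, ‖coeff (d + e) f‖ₑ * wt ρ (d + e) := by
        refine ENNReal.tsum_le_tsum fun d => ?_
        rw [wt_add, mul_assoc]
        gcongr
        exact h d
    _ ≤ _ := ENNReal.tsum_comp_le_tsum_of_injective (add_left_injective e)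
        (fun d => ‖coeff d f‖ₑ * wt ρ d)

lemma isConvergent_of_enorm_coeff_le [NormedField K] {f g : MvPowerSeries σ K} {e : σ →₀ ℕ}
    (hf : f.IsConvergent) (h : ∀ d, ‖coeff d g‖ₑ ≤ ‖coeff (d + e) f‖ₑ) : g.IsConvergent := by
  obtain ⟨r, hr, hr'⟩ := isConvergent_iff.1 hf
  refine isConvergent_iff.2 ⟨r, hr, fun hg => ?_⟩
  have := wnorm_mul_wt_le (fun _ => r) h
  rw [hg, wt_const, ENNReal.top_mul (pow_ne_zero _ hr), top_le_iff] at this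
  exact hr' this

/-- A power series in `σ ⊕ ω` is its value at `ω = 0` plus a combination of the variables `ω`. -/
theorem exists_eq_subst_add_sum [NormedField K] [Fintype ω] [Finite σ]
    (F : MvPowerSeries (σ ⊕ ω) K) :
    ∃ (F₀ : MvPowerSeries σ K) (G : ω → MvPowerSeries (σ ⊕ ω) K),
      F = subst (fun i => X (Sum.inl i)) F₀ + ∑ j, X (Sum.inr j) * G j ∧
      (F.IsConvergent → F₀.IsConvergent ∧ ∀ j, (G j).IsConvergent) := by
  classical
  let e : σ ↪ σ ⊕ ω := Function.Embedding.inl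
  -- Each monomial involving `ω` is assigned to one variable dividing it. As every coefficient of
  -- `F` goes to a single `G j`, convergence is inherited without estimates.
  have hpick : ∀ d : σ ⊕ ω →₀ ℕ, ∃ j : Option ω, (∀ i, j = some i → d (Sum.inr i) ≠ 0) ∧
      (j = none → ∀ i, d (Sum.inr i) = 0) := by
    intro d
    by_cases h : ∃ i, d (Sum.inr i) ≠ 0
    · obtain ⟨i, hi⟩ := h
      exact ⟨some i, by rintro _ ⟨⟩; exact hi, by simp⟩
    · push Not at h
      exact ⟨none, by simp, fun _ => h⟩
  choose pick hp1 hp2 using hpick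
  let G : ω → MvPowerSeries (σ ⊕ ω) K := fun j d =>
    if pick (d + Finsupp.single (Sum.inr j) 1) = some j
      then coeff (d + Finsupp.single (Sum.inr j) 1) F else 0
  have hG : ∀ j d, coeff d (G j) = if pick (d + Finsupp.single (Sum.inr j) 1) = some j
      then coeff (d + Finsupp.single (Sum.inr j) 1) F else 0 := fun j d => rfl
  have hXG : ∀ j d, coeff d (X (Sum.inr j) * G j) = if pick d = some j then coeff d F else 0 := by
    intro j d
    rw [X, coeff_monomial_mul]
    by_cases hj : Finsupp.single (Sum.inr j) 1 ≤ d
    · rw [if_pos hj, hG, tsub_add_cancel_of_le hj, one_mul]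
    · rw [if_neg hj, if_neg]
      intro h
      have := hp1 d j h
      exact hj (Finsupp.single_le_iff.2 (Nat.one_le_iff_ne_zero.2 this))
  refine ⟨killCompl e F, G, ?_, ?_⟩
  · have hren : subst (fun i => X (Sum.inl i)) (killCompl e F) = rename e (killCompl e F) :=
      (rename_eq_subst ..).symm
    rw [hren]
    ext d
    rw [map_add, map_sum, Finset.sum_congr rfl fun j _ => hXG j d]
    cases hd : pick d with
    | none =>
      have hd0 := hp2 d hd
      have : ∃ d' : σ →₀ ℕ, d'.embDomain e = d := by
        refine ⟨d.comapDomain Sum.inl Sum.inl_injective.injOn, ?_⟩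
        ext i
        rcases i with i | i
        · exact (Finsupp.embDomain_apply_self e _ i).trans (by simp)
        · rw [hd0 i]
          exact Finsupp.embDomain_of_notMem_range _ _ _ (by simp [e])
      obtain ⟨d', rfl⟩ := this
      rw [coeff_embDomain_rename, coeff_killCompl]
      simp
    | some i =>
      rw [coeff_rename_eq_zero]
      · simp
      · rintro ⟨d', hd'⟩
        apply hp1 d i hd
        rw [← hd', Finsupp.mapDomain_of_notMem_range]
        simp [e]
  · intro hF
    refine ⟨?_, fun j => isConvergent_of_enorm_coeff_le (e := Finsupp.single (Sum.inr j) 1) hF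
      fun d => ?_⟩
    · obtain ⟨r, hr, hr'⟩ := isConvergent_iff.1 hF
      refine isConvergent_iff.2 ⟨r, hr, ne_top_of_le_ne_top hr' ?_⟩
      rw [wnorm]
      calc _ = ∑' d : σ →₀ ℕ, ‖coeff (d.embDomain e) F‖ₑ * wt (fun _ => r) (d.embDomain e) := by
            refine tsum_congr fun d => ?_
            rw [coeff_killCompl, wt, wt, Finsupp.prod_embDomain]
        _ ≤ _ := ENNReal.tsum_comp_le_tsum_of_injective (Finsupp.embDomain_injective e)
            (fun d => ‖coeff d F‖ₑ * wt (fun _ => r) d)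
    · rw [hG]
      split_ifs <;> simp

end Hadamard

end MvPowerSeries

namespace MvPowerSeries

/-! ### Chain rule and Taylor expansion -/

section Taylor

variable {σ τ ω ν : Type*} {K : Type*} [NormedField K]

lemma subst_sum [Finite σ] {ι : Type*} {a : σ → MvPowerSeries τ K} (ha : HasSubst a) (s : Finset ι)
    (f : ι → MvPowerSeries σ K) : subst a (∑ i ∈ s, f i) = ∑ i ∈ s, subst a (f i) := by
  rw [← coe_substAlgHom ha, map_sum]

lemma subst_zero' {a : σ → MvPowerSeries τ K} (ha : HasSubst a) :
    subst a (0 : MvPowerSeries σ K) = 0 := by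
  rw [← coe_substAlgHom ha, map_zero]

lemma subst_C' {a : σ → MvPowerSeries τ K} (c : K) :
    subst a (C c : MvPowerSeries σ K) = (C c : MvPowerSeries τ K) := subst_C c

/-- Substitution respects congruences modulo an arbitrary ideal. -/
theorem subst_sub_subst_mem [Finite σ] {a b : σ → MvPowerSeries τ K}
    (ha : ∀ i, constantCoeff (a i) = 0) (hb : ∀ i, constantCoeff (b i) = 0)
    (I : Ideal (MvPowerSeries τ K)) (h : ∀ i, a i - b i ∈ I) (f : MvPowerSeries σ K) :
    subst a f - subst b f ∈ I := by
  cases nonempty_fintype σ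
  -- Splitting `f(x + z)` gives the exact finite identity `f(b + c) = f(b) + ∑ c j * (...)`, so `I`
  -- need not be closed.
  obtain ⟨F₀, G, hF, -⟩ := exists_eq_subst_add_sum
    (subst (fun i => (X (Sum.inl i) + X (Sum.inr i) : MvPowerSeries (σ ⊕ σ) K)) f)
  have hX : HasSubst (fun i => (X (Sum.inl i) + X (Sum.inr i) : MvPowerSeries (σ ⊕ σ) K)) :=
    hasSubst_of_constantCoeff_zero (by simp)
  have hX' : HasSubst (fun i : σ => (X (Sum.inl i) : MvPowerSeries (σ ⊕ σ) K)) :=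
    hasSubst_of_constantCoeff_zero (by simp)
  have key : ∀ c : σ → MvPowerSeries τ K, (∀ i, constantCoeff (c i) = 0) →
      subst (fun i => b i + c i) f =
        subst b F₀ + ∑ j, c j * subst (Sum.elim b c) (G j) := by
    intro c hc
    have hbc : HasSubst (Sum.elim b c) := hasSubst_of_constantCoeff_zero (by simp [hb, hc])
    have := congrArg (subst (Sum.elim b c)) hF
    rw [subst_subst hX hbc, subst_add hbc, subst_subst hX' hbc, subst_sum hbc] at this
    simpa [subst_add hbc, subst_mul hbc, subst_X hbc] using this
  have h1 := key (fun i => a i - b i) (by simp [ha, hb])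
  have h2 := key 0 (by simp)
  simp only [add_sub_cancel] at h1
  simp only [Pi.zero_apply, add_zero, zero_mul, Finset.sum_const_zero] at h2
  rw [h1, h2, add_sub_cancel_left]
  exact sum_mem fun i _ => Ideal.mul_mem_right _ _ (h i)

/-- The splitting with no base variables; it drives later inductions on the order. -/
lemma exists_eq_C_add_sum [Fintype σ] (f : MvPowerSeries σ K) :
    ∃ (c : K) (g : σ → MvPowerSeries σ K), f = C c + ∑ i, X i * g i := by
  obtain ⟨F₀, G, hF, -⟩ := exists_eq_subst_add_sum (σ := Empty) (ω := σ)
    (subst (fun i => (X (Sum.inr i) : MvPowerSeries (Empty ⊕ σ) K)) f)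
  obtain ⟨c, rfl⟩ := C_surjective F₀
  have h1 : HasSubst (fun i : σ => (X (Sum.inr i) : MvPowerSeries (Empty ⊕ σ) K)) :=
    hasSubst_of_constantCoeff_zero (by simp)
  have h2 : HasSubst (Sum.elim Empty.elim X : Empty ⊕ σ → MvPowerSeries σ K) :=
    hasSubst_of_constantCoeff_zero (by
      rintro (i | i)
      · exact i.elim
      · simp)
  have := congrArg (subst (Sum.elim Empty.elim X : Empty ⊕ σ → MvPowerSeries σ K)) hF
  rw [subst_subst h1 h2, subst_add h2, subst_sum h2, subst_C', subst_C'] at this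
  simp only [subst_X h2, Sum.elim_inr, subst_mul h2] at this
  refine ⟨c, _, Eq.trans ?_ this⟩
  exact (congrFun subst_self f).symm

/-- The chain rule for substitution and a derivation of the ring of power series. -/
theorem derivation_subst [Fintype σ] {a : σ → MvPowerSeries τ K}
    (ha : ∀ i, constantCoeff (a i) = 0) (D : Derivation K (MvPowerSeries τ K) (MvPowerSeries τ K))
    (f : MvPowerSeries σ K) :
    D (subst a f) = ∑ i, subst a (pderiv K i f) * D (a i) := by
  classical
  have hs : HasSubst a := hasSubst_of_constantCoeff_zero ha
  rw [← sub_eq_zero]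
  -- No continuity of `D` is assumed. Writing `f = c + ∑ X i * g i`, the defect of the chain rule
  -- for `f` is `∑ a i` times the defect for `g i`, so it gains one order in each round.
  refine eq_zero_of_forall_mem_wIdeal (w := fun _ => 1) fun k => ?_
  induction k generalizing f with
  | zero => exact mem_wIdeal_zero _ _
  | succ k ih =>
    obtain ⟨c, g, rfl⟩ := exists_eq_C_add_sum f
    have hD : D (C c) = 0 := by
      have := D.map_algebraMap c
      rwa [← c_eq_algebraMap] at this
    have : D (subst a (C c + ∑ i, X i * g i)) -
        ∑ i, subst a (pderiv K i (C c + ∑ i, X i * g i)) * D (a i) =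
        ∑ i, a i * (D (subst a (g i)) - ∑ j, subst a (pderiv K j (g i)) * D (a j)) := by
      have h1 : ∀ i, pderiv K i (C c + ∑ j, X j * g j) = g i + ∑ j, X j * pderiv K i (g j) := by
        intro i
        simp [pderiv_C, Derivation.leibniz, pderiv_X, Finset.sum_add_distrib, Pi.single_apply,
          add_comm]
      simp only [h1, subst_add hs, subst_sum hs, subst_mul hs, subst_X hs, map_add, map_sum,
        subst_C', hD, Derivation.leibniz, smul_eq_mul, zero_add, add_mul, mul_sub,
        Finset.sum_add_distrib, Finset.sum_sub_distrib, Finset.sum_mul, Finset.mul_sum]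
      rw [Finset.sum_comm (f := fun i j => a j * subst a (pderiv K i (g j)) * D (a i))]
      simp only [mul_assoc]
      ring
    rw [this, add_comm k 1]
    exact sum_mem fun i _ => mul_mem_wIdeal (mem_wIdeal_one_iff.2 (ha i)) (ih (g i))

/-- Taylor expansion to second order in the directions of the variables `κ j`. -/
theorem exists_taylor [Fintype ν] [DecidableEq ν] [Fintype ω] (κ : ω → ν) (f : MvPowerSeries ν K) :
    ∃ h : ω → ω → MvPowerSeries (ν ⊕ ω) K,
      subst (fun i => X (Sum.inl i) + ∑ j, if κ j = i then X (Sum.inr j) else 0) f =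
        subst (fun i => X (Sum.inl i)) f +
        ∑ j, X (Sum.inr j) * subst (fun i => X (Sum.inl i)) (pderiv K (κ j) f) +
        ∑ j, ∑ k, X (Sum.inr j) * X (Sum.inr k) * h j k ∧
      (f.IsConvergent → (∀ j, (pderiv K (κ j) f).IsConvergent) ∧ ∀ j k, (h j k).IsConvergent) := by
  classical
  set θ : ν → MvPowerSeries (ν ⊕ ω) K :=
    fun i => X (Sum.inl i) + ∑ j, if κ j = i then X (Sum.inr j) else 0 with hθ
  set ι : ν → MvPowerSeries (ν ⊕ ω) K := fun i => X (Sum.inl i) with hι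
  have hι0 : ∀ i, constantCoeff (ι i) = 0 := by simp [hι]
  have hθ0 : ∀ i, constantCoeff (θ i) = 0 := by
    intro i
    simp only [hθ, map_add, map_sum, constantCoeff_X, zero_add]
    exact Finset.sum_eq_zero fun j _ => by split_ifs <;> simp
  have hθc : ∀ i, (θ i).IsConvergent := by
    intro i
    refine IsConvergent.add (isConvergent_X _) (mem_convergent.1 (sum_mem fun j _ => ?_))
    split_ifs
    · exact isConvergent_X _
    · exact zero_mem (convergent _ K)
  obtain ⟨F₀, G, hF, hFc⟩ := exists_eq_subst_add_sum (subst θ f)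
  change subst θ f = subst ι F₀ + _ at hF
  -- Splitting a second time, now each `G j`, gives the terms of first and second order.
  choose F₁ h hG hGc using fun j => exists_eq_subst_add_sum (G j)
  have hsι : HasSubst ι := hasSubst_of_constantCoeff_zero hι0
  have hsθ : HasSubst θ := hasSubst_of_constantCoeff_zero hθ0
  -- Setting the variables `ω` to zero, before or after one differentiation, identifies `F₀` and
  -- `F₁`.
  set ε : ν ⊕ ω → MvPowerSeries ν K := Sum.elim X 0 with hε
  have hε0 : HasSubst ε := hasSubst_of_constantCoeff_zero (by simp [hε])
  have hεl : ∀ i, ε (Sum.inl i) = X i := fun i => rfl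
  have hεr : ∀ j, ε (Sum.inr j) = 0 := fun j => rfl
  have hει : ∀ F : MvPowerSeries ν K, subst ε (subst ι F) = F := by
    intro F
    rw [subst_subst hsι hε0]
    simp only [hι, subst_X hε0, hεl]
    exact congrFun subst_self F
  have hεθ : ∀ F : MvPowerSeries ν K, subst ε (subst θ F) = F := by
    intro F
    rw [subst_subst hsθ hε0]
    have : (fun i => subst ε (θ i)) = (X : ν → MvPowerSeries ν K) := by
      funext i
      simp only [hθ, subst_add hε0, subst_sum hε0, subst_X hε0, hεl]
      rw [Finset.sum_eq_zero, add_zero]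
      intro j _
      split_ifs
      · rw [subst_X hε0, hεr]
      · exact subst_zero' hε0
    rw [this]
    exact congrFun subst_self F
  have h0 : F₀ = f := by
    have := congrArg (subst ε) hF
    rw [hεθ, subst_add hε0, hει, subst_sum hε0] at this
    simpa [subst_mul hε0, subst_X hε0, hεr] using this.symm
  have h1 : ∀ j, F₁ j = pderiv K (κ j) f := by
    intro j
    have := congrArg (fun F => subst ε (pderiv K (Sum.inr j) F)) hF
    simp only [map_add, map_sum, derivation_subst hθ0, derivation_subst hι0] at this
    have e1 : ∀ i, pderiv K (Sum.inr j) (ι i) = 0 := fun i => pderiv_X_of_ne (by simp)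
    have e2 : ∀ i, pderiv K (Sum.inr j) (θ i) = if κ j = i then 1 else 0 := by
      intro i
      simp only [hθ, map_add, map_sum]
      rw [show pderiv K (Sum.inr j) (X (Sum.inl i) : MvPowerSeries (ν ⊕ ω) K) = 0 from e1 i,
        zero_add, Finset.sum_eq_single j]
      · split_ifs <;> simp
      · intro k _ hk
        split_ifs
        · exact pderiv_X_of_ne (by simpa using hk)
        · simp
      · simp
    simp only [e1, e2, mul_zero, Finset.sum_const_zero, zero_add, mul_ite, mul_one,
      Finset.sum_ite_eq, Finset.mem_univ, if_true, hεθ] at this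
    rw [this, subst_sum hε0, Finset.sum_eq_single j]
    · rw [Derivation.leibniz, pderiv_X_self, subst_add hε0, smul_eq_mul, smul_eq_mul,
        subst_mul hε0, subst_X hε0, mul_one, hG, subst_add hε0, hει, subst_sum hε0]
      simp [hεr, subst_mul hε0, subst_X hε0]
    · intro k _ hk
      rw [Derivation.leibniz, pderiv_X_of_ne (by simpa using hk), subst_add hε0, smul_eq_mul,
        subst_mul hε0, subst_X hε0]
      simp [hεr, subst_zero' hε0]
    · simp
  refine ⟨fun j k => h j k, ?_, fun hf => ?_⟩
  · rw [hF, h0, add_assoc, ← Finset.sum_add_distrib]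
    congr 1
    refine Finset.sum_congr rfl fun j _ => ?_
    rw [hG, h1, mul_add, Finset.mul_sum]
    simp only [mul_assoc]
    rfl
  · have hc := hFc (hf.subst hθc hθ0)
    exact ⟨fun j => h1 j ▸ (hGc j (hc.2 j)).1, fun j k => (hGc j (hc.2 j)).2 k⟩

/-- The derivative is the linear coefficient in the Taylor expansion, whose convergence is already
known; no bound on the exponents that appear as factors is needed. -/
lemma IsConvergent.pderiv [Fintype ν] {f : MvPowerSeries ν K} (hf : f.IsConvergent) (i : ν) :
    (pderiv K i f).IsConvergent := by
  classical
  obtain ⟨h, -, hc⟩ := exists_taylor (fun _ : Unit => i) f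
  exact (hc hf).1 ()

end Taylor

end MvPowerSeries

namespace MvPowerSeries

/-! ### Implicit functions and Tougeron's theorem -/

section Implicit

variable {σ τ ω ν : Type*} {K : Type*} [NormedField K]

lemma constantCoeff_eq_zero_of_sub_mem {f g : MvPowerSeries σ K} (hg : constantCoeff g = 0)
    (h : f - g ∈ wIdeal (fun _ => 1) 1) : constantCoeff f = 0 := by
  rw [mem_wIdeal_one_iff, map_sub, hg, sub_zero] at h
  exact h

/-- The implicit function theorem, as a fixed point statement. -/
theorem exists_implicit [Fintype ω] [Finite τ] (c : ω → MvPowerSeries τ K)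
    (hc : ∀ j, constantCoeff (c j) = 0) (G : ω → ω → MvPowerSeries (τ ⊕ ω) K)
    (hG : ∀ j k, constantCoeff (G j k) = 0) :
    ∃ u : ω → MvPowerSeries τ K, (∀ j, constantCoeff (u j) = 0) ∧
      (∀ j, u j = c j + ∑ k, u k * subst (Sum.elim X u) (G j k)) ∧
      (∀ j, u j ∈ Ideal.span (Set.range c)) ∧
      ((∀ j, (c j).IsConvergent) → (∀ j k, (G j k).IsConvergent) → ∀ j, (u j).IsConvergent) := by
  classical
  cases nonempty_fintype τ
  set Φ : (ω → MvPowerSeries τ K) → ω → MvPowerSeries τ K :=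
    fun u j => c j + ∑ k, u k * subst (Sum.elim X u) (G j k) with hΦ
  have hel : ∀ u : ω → MvPowerSeries τ K, (∀ j, constantCoeff (u j) = 0) →
      ∀ i, constantCoeff (Sum.elim X u i : MvPowerSeries τ K) = 0 := by
    rintro u hu (i | i) <;> simp [hu]
  have hΦ0 : ∀ u : ω → MvPowerSeries τ K, (∀ j, constantCoeff (u j) = 0) →
      ∀ j, constantCoeff (Φ u j) = 0 := by
    intro u hu j
    simp [hΦ, hc, hu]
  have hcon : ∀ u v : ω → MvPowerSeries τ K, (∀ j, constantCoeff (u j) = 0) →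
      (∀ j, constantCoeff (v j) = 0) → ∀ k, (∀ j, u j - v j ∈ wIdeal (fun _ => 1) k) →
      ∀ j, Φ u j - Φ v j ∈ wIdeal (fun _ => 1) (k + 1) := by
    intro u v hu hv k huv j
    have : Φ u j - Φ v j = ∑ l, ((u l - v l) * subst (Sum.elim X u) (G j l) +
        (subst (Sum.elim X u) (G j l) - subst (Sum.elim X v) (G j l)) * v l) := by
      simp only [hΦ, add_sub_add_left_eq_sub, ← Finset.sum_sub_distrib]
      exact Finset.sum_congr rfl fun l _ => by ring
    rw [this]
    refine sum_mem fun l _ => add_mem (mul_mem_wIdeal (huv l) ?_) (mul_mem_wIdeal ?_ ?_)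
    · rw [mem_wIdeal_one_iff, constantCoeff_subst_zero (hel u hu), hG]
    · refine subst_sub_subst_mem (hel u hu) (hel v hv) _ ?_ _
      rintro (i | i)
      · simp
      · exact huv i
    · exact mem_wIdeal_one_iff.2 (hv l)
  -- The fixed point is sought in a variable set `S`: with a norm bound when the data converge,
  -- without one otherwise.
  have main : ∀ S : Set (ω → MvPowerSeries τ K), (0 : ω → MvPowerSeries τ K) ∈ S →
      (∀ u ∈ S, ∀ j, constantCoeff (u j) = 0) → (∀ u ∈ S, Φ u ∈ S) →
      (∀ u, (∀ k, ∃ v ∈ S, ∀ j, u j - v j ∈ wIdeal (fun _ => 1) k) → u ∈ S) →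
      ∃ u ∈ S, Φ u = u := fun S h0 hS h1 h2 =>
    exists_fixedPoint (fun _ => 1) S Φ h0 h1
      (fun u hu v hv k huv => hcon u v (hS u hu) (hS v hv) k huv) h2
  have hspan : ∀ u : ω → MvPowerSeries τ K, (∀ j, constantCoeff (u j) = 0) → Φ u = u →
      ∀ j, u j ∈ Ideal.span (Set.range c) := by
    intro u hu hfix
    -- The fixed point equation reads `M u = c`, and `M` is invertible because it is the identity at
    -- the origin; Cramer's rule puts `u` in the span of `c`.
    set M : Matrix ω ω (MvPowerSeries τ K) :=
      1 - Matrix.of fun j k => subst (Sum.elim X u) (G j k) with hM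
    have hMu : M.mulVec u = c := by
      funext j
      have := congrFun hfix j
      simp only [hΦ] at this
      rw [hM, Matrix.sub_mulVec, Matrix.one_mulVec, Pi.sub_apply, ← this, Matrix.mulVec,
        dotProduct, this]
      simp only [Matrix.of_apply]
      rw [sub_eq_iff_eq_add, ← this]
      congr 1
      exact Finset.sum_congr rfl fun k _ => mul_comm _ _
    have hdet : IsUnit M.det := by
      rw [isUnit_iff_constantCoeff, RingHom.map_det]
      have : constantCoeff.mapMatrix M = 1 := by
        ext j k
        simp only [hM, RingHom.mapMatrix_apply, Matrix.map_apply, Matrix.sub_apply, map_sub,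
          Matrix.of_apply, constantCoeff_subst_zero (hel u hu), hG, sub_zero]
        rw [Matrix.one_apply, Matrix.one_apply]
        split_ifs <;> simp
      rw [this, Matrix.det_one]
      exact isUnit_one
    intro j
    have h1 : M.det • u = M.adjugate.mulVec c := by
      rw [← hMu, Matrix.mulVec_mulVec, Matrix.adjugate_mul, Matrix.smul_mulVec, Matrix.one_mulVec]
    have h2 : M.det * u j ∈ Ideal.span (Set.range c) := by
      have := congrFun h1 j
      rw [Pi.smul_apply, smul_eq_mul] at this
      rw [this, Matrix.mulVec, dotProduct]
      exact sum_mem fun k _ => Ideal.mul_mem_left _ _ (Ideal.subset_span ⟨k, rfl⟩)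
    exact (Ideal.unit_mul_mem_iff_mem _ hdet).1 h2
  by_cases hconv : (∀ j, (c j).IsConvergent) ∧ ∀ j k, (G j k).IsConvergent
  · obtain ⟨hcc, hGc⟩ := hconv
    -- With `G` bounded by `N`, the sum over `ω` contributes at most `ε / 2`. The `+ 1` covers an
    -- empty `ω`.
    set N : ℝ≥0∞ := (2 * (Fintype.card ω + 1))⁻¹ with hN
    have hN0 : N ≠ 0 := by
      rw [hN, ENNReal.inv_ne_zero]
      exact ENNReal.mul_ne_top (by simp) (by simp)
    obtain ⟨ε, hε, hε', hεG⟩ := IsConvergent.exists_wnorm_le (f := fun p : ω × ω => G p.1 p.2)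
      (fun p => hGc _ _) (fun p => hG _ _) hN0
    -- The radius `ε` for `u` is fixed before the radius `η ≤ ε` for `x`, so that `G` stays small
    -- while `c` is made at most `ε / 2`.
    obtain ⟨η', hη', -, hηc⟩ := IsConvergent.exists_wnorm_le hcc hc (ε := ε / 2)
      (ENNReal.div_ne_zero.2 ⟨hε, by simp⟩)
    set η := min η' ε with hη
    have hη0 : η ≠ 0 := by
      intro h
      rcases min_eq_bot.1 h with h | h
      · exact hη' h
      · exact hε h
    obtain ⟨u, ⟨hu0, hun⟩, hfix⟩ := main
      {u | (∀ j, constantCoeff (u j) = 0) ∧ ∀ j, wnorm (fun _ => η) (u j) ≤ ε}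
      ⟨by simp, by simp⟩ (fun u hu => hu.1) (fun u hu => ⟨hΦ0 u hu.1, fun j => by
        have hbound : ∀ k, wnorm (fun _ => η) (u k * subst (Sum.elim X u) (G j k)) ≤ ε * N := by
          intro k
          refine (wnorm_mul_le _ _ _).trans (mul_le_mul' (hu.2 k) ?_)
          refine (wnorm_subst_le _ (hasSubst_of_constantCoeff_zero (hel u hu.1)) _).trans ?_
          refine le_trans (wnorm_mono (fun i => ?_) _) (hεG (j, k))
          rcases i with i | i
          · simp [hη]
          · exact hu.2 i
        have hsum : ∀ s : Finset ω, wnorm (fun _ => η)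
            (∑ k ∈ s, u k * subst (Sum.elim X u) (G j k)) ≤ s.card * (ε * N) := by
          intro s
          induction s using Finset.induction_on with
          | empty => simp
          | insert a s ha ih =>
            rw [Finset.sum_insert ha, Finset.card_insert_of_notMem ha]
            push_cast
            rw [add_mul, one_mul]
            exact (wnorm_add_le _ _ _).trans ((add_comm _ _).trans_le (add_le_add ih (hbound a)))
        calc wnorm (fun _ => η) (Φ u j)
            ≤ wnorm (fun _ => η) (c j) + Fintype.card ω * (ε * N) :=
              (wnorm_add_le _ _ _).trans (add_le_add le_rfl (hsum Finset.univ))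
          _ ≤ ε / 2 + ε / 2 := by
              refine add_le_add ((wnorm_mono (fun _ => min_le_left _ _) _).trans (hηc j)) ?_
              have : (Fintype.card ω : ℝ≥0∞) * (ε * N) ≤ (Fintype.card ω + 1) * (ε * N) := by
                gcongr; exact le_self_add
              refine this.trans (le_of_eq ?_)
              rw [hN, ENNReal.mul_inv (by simp) (by simp), ENNReal.div_eq_inv_mul]
              calc _ = (((Fintype.card ω : ℝ≥0∞) + 1) * ((Fintype.card ω : ℝ≥0∞) + 1)⁻¹) *
                    (2⁻¹ * ε) := by ring
                _ = _ := by rw [ENNReal.mul_inv_cancel (by simp) (by simp), one_mul]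
          _ = ε := ENNReal.add_halves ε⟩)
      (fun u hu => ⟨fun j => by
        obtain ⟨v, hv, h⟩ := hu 1
        exact constantCoeff_eq_zero_of_sub_mem (hv.1 j) (h j), fun j =>
        wnorm_le_of_forall_exists (fun _ => 1) _ fun k => by
          obtain ⟨v, hv, h⟩ := hu k
          exact ⟨v j, hv.2 j, h j⟩⟩)
    exact ⟨u, hu0, fun j => (congrFun hfix j).symm, hspan u hu0 hfix, fun _ _ j =>
      isConvergent_of_wnorm (ρ := fun _ => η) (fun _ => hη0) (ne_top_of_le_ne_top hε' (hun j))⟩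
  · obtain ⟨u, hu0, hfix⟩ := main {u | ∀ j, constantCoeff (u j) = 0} (by simp) (fun u hu => hu)
      (fun u hu => hΦ0 u hu) (fun u hu j => by
        obtain ⟨v, hv, h⟩ := hu 1
        exact constantCoeff_eq_zero_of_sub_mem (hv j) (h j))
    exact ⟨u, hu0, fun j => (congrFun hfix j).symm, hspan u hu0 hfix,
      fun h1 h2 => absurd ⟨h1, h2⟩ hconv⟩

/-- Taylor expansion to second order at a point. -/
theorem exists_taylor_subst (τ : Type*) [Fintype ν] [DecidableEq ν] [Fintype ω] (κ : ω → ν)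
    (f : MvPowerSeries ν K) :
    ∃ h : ω → ω → MvPowerSeries (ν ⊕ ω) K,
      (∀ (p : ν → MvPowerSeries τ K) (v : ω → MvPowerSeries τ K),
        (∀ i, constantCoeff (p i) = 0) → (∀ j, constantCoeff (v j) = 0) →
        subst (fun l => p l + ∑ j, if κ j = l then v j else 0) f =
          subst p f + ∑ j, v j * subst p (pderiv K (κ j) f) +
          ∑ j, ∑ k, v j * v k * subst (Sum.elim p v) (h j k)) ∧
      (f.IsConvergent → ∀ j k, (h j k).IsConvergent) := by
  obtain ⟨h, hT, hTc⟩ := exists_taylor κ f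
  refine ⟨h, fun p v hp hv => ?_, fun hf => (hTc hf).2⟩
  have hVs : HasSubst (Sum.elim p v) := hasSubst_of_constantCoeff_zero (by
    rintro (i | i) <;> simp [hp, hv])
  have hθs : HasSubst (fun i => (X (Sum.inl i) + ∑ j, if κ j = i then X (Sum.inr j) else 0 :
      MvPowerSeries (ν ⊕ ω) K)) := hasSubst_of_constantCoeff_zero (by
    intro i
    simp only [map_add, map_sum, constantCoeff_X, zero_add]
    exact Finset.sum_eq_zero fun j _ => by split_ifs <;> simp)
  have hιs : HasSubst (fun i => (X (Sum.inl i) : MvPowerSeries (ν ⊕ ω) K)) :=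
    hasSubst_of_constantCoeff_zero (by simp)
  have := congrArg (subst (Sum.elim p v)) hT
  rw [subst_subst hθs hVs, subst_add hVs, subst_add hVs, subst_sum hVs, subst_sum hVs,
    subst_subst hιs hVs] at this
  simp only [subst_mul hVs, subst_add hVs, subst_sum hVs, subst_X hVs, subst_subst hιs hVs,
    Sum.elim_inl, Sum.elim_inr] at this
  rw [← this]
  congr 1
  funext l
  congr 1
  refine Finset.sum_congr rfl fun j _ => ?_
  split_ifs
  · rw [subst_X hVs]; rfl
  · rw [subst_zero' hVs]

/-- Tougeron's implicit function theorem: an approximate solution `p` of `g = 0` whose error is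
divisible by the square of a Jacobian determinant can be corrected to a solution. -/
theorem exists_tougeron [Fintype ω] [DecidableEq ω] [Fintype ν] [DecidableEq ν] [Finite τ]
    (g : ω → MvPowerSeries ν K) (κ : ω → ν) (p : ν → MvPowerSeries τ K)
    (hp : ∀ i, constantCoeff (p i) = 0) (a b : MvPowerSeries τ K) (q : ω → MvPowerSeries τ K)
    (hJ : (Matrix.of fun i j => subst p (pderiv K (κ j) (g i))).det = a * b) (ha : a ≠ 0)
    (hb : constantCoeff b ≠ 0) (hg : ∀ i, subst p (g i) = a ^ 2 * q i)
    (hq : ∀ i, constantCoeff (q i) = 0) :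
    ∃ u : ω → MvPowerSeries τ K, (∀ j, constantCoeff (u j) = 0) ∧
      (∀ i, subst (fun l => p l + ∑ j, if κ j = l then a * u j else 0) (g i) = 0) ∧
      (∀ j, u j ∈ Ideal.span (Set.range q)) ∧
      ((∀ i, (g i).IsConvergent) → (∀ i, (p i).IsConvergent) → a.IsConvergent → b.IsConvergent →
        (∀ i, (q i).IsConvergent) → ∀ j, (u j).IsConvergent) := by
  choose h hT hTc using fun i => exists_taylor_subst τ κ (g i)
  set J := Matrix.of fun i j => subst p (pderiv K (κ j) (g i)) with hJdef
  have hps : HasSubst p := hasSubst_of_constantCoeff_zero hp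
  set β := constantCoeff b with hβ
  let ι : MvPowerSeries τ K → MvPowerSeries (τ ⊕ ω) K := subst fun i => X (Sum.inl i)
  have hιX : ∀ i : τ, constantCoeff (X (Sum.inl i) : MvPowerSeries (τ ⊕ ω) K) = 0 := by simp
  have hι : HasSubst (fun i : τ => (X (Sum.inl i) : MvPowerSeries (τ ⊕ ω) K)) :=
    hasSubst_of_constantCoeff_zero hιX
  have hι0 : ∀ f, constantCoeff (ι f) = constantCoeff f := fun f => constantCoeff_subst_zero hιX f
  have hιc : ∀ f, f.IsConvergent → (ι f).IsConvergent :=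
    fun f hf => hf.subst (fun i => isConvergent_X _) hιX
  let P : ν ⊕ ω → MvPowerSeries (τ ⊕ ω) K :=
    Sum.elim (fun i => ι (p i)) fun j => ι a * X (Sum.inr j)
  have hP0 : ∀ i, constantCoeff (P i) = 0 := by
    rintro (i | i)
    · exact (hι0 _).trans (hp i)
    · simp [P]
  have hPs : HasSubst P := hasSubst_of_constantCoeff_zero hP0
  -- By Taylor's formula `g(p + a u) = a² q + a J u + a² Q(u)`, with `Q` of second order. Multiplied
  -- by the adjugate of `J` this becomes `a² (adj J · q + b u + adj J · Q(u))`. Solving for `β u`,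
  -- where `b = β + (b - β)`, puts the equation into the form of `exists_implicit`.
  let c : ω → MvPowerSeries τ K := fun j => C (-β⁻¹) * ∑ i, J.adjugate j i * q i
  let G : ω → ω → MvPowerSeries (τ ⊕ ω) K := fun j k => C (-β⁻¹) *
    ((if j = k then ι (b - C β) else 0) +
      ∑ l, X (Sum.inr l) * ∑ i, ι (J.adjugate j i) * subst P (h i k l))
  obtain ⟨u, hu0, hu, hus, huc⟩ := exists_implicit c (fun j => by simp [c, hq]) G (fun j k => by
    simp only [G, map_mul, map_add, map_sum, constantCoeff_X, zero_mul, Finset.sum_const_zero,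
      add_zero]
    split_ifs
    · rw [hι0]; simp [hβ]
    · simp)
  have hue : HasSubst (Sum.elim X u : τ ⊕ ω → MvPowerSeries τ K) :=
    hasSubst_of_constantCoeff_zero (by rintro (i | i) <;> simp [hu0])
  have huι : ∀ f, subst (Sum.elim X u : τ ⊕ ω → MvPowerSeries τ K) (ι f) = f := by
    intro f
    rw [subst_subst hι hue]
    simp only [subst_X hue, Sum.elim_inl]
    exact congrFun subst_self f
  set V : ν ⊕ ω → MvPowerSeries τ K := Sum.elim p fun j => a * u j with hV
  have hV0 : ∀ i, constantCoeff (V i) = 0 := by rintro (i | i) <;> simp [hV, hp, hu0]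
  have hVs : HasSubst V := hasSubst_of_constantCoeff_zero hV0
  have huP : ∀ f : MvPowerSeries (ν ⊕ ω) K, subst (Sum.elim X u : τ ⊕ ω → MvPowerSeries τ K) (subst P f) =
      subst V f := by
    intro f
    rw [subst_subst hPs hue]
    congr 1
    funext i
    rcases i with i | i
    · exact huι _
    · simp [P, hV, subst_mul hue, huι, subst_X hue]
  have huG : ∀ j k, subst (Sum.elim X u) (G j k) = C (-β⁻¹) * ((if j = k then b - C β else 0) +
      ∑ l, u l * ∑ i, J.adjugate j i * subst V (h i k l)) := by
    intro j k
    simp only [G, subst_mul hue, subst_add hue, subst_sum hue, subst_C', huι, huP, subst_X hue,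
      Sum.elim_inr]
    congr 2
    split_ifs
    · exact huι _
    · exact subst_zero' hue
  -- the second order terms
  set Q : ω → MvPowerSeries τ K := fun i => ∑ k, ∑ l, u k * u l * subst V (h i k l) with hQ
  have hbr : ∀ j, ∑ i, J.adjugate j i * q i + b * u j + ∑ i, J.adjugate j i * Q i = 0 := by
    intro j
    have h1 : C β * u j = -(∑ i, J.adjugate j i * q i) - (b - C β) * u j -
        ∑ k, u k * ∑ l, u l * ∑ i, J.adjugate j i * subst V (h i k l) := by
      have hββ : (C β * C (-β⁻¹) : MvPowerSeries τ K) = -1 := by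
        rw [← map_mul, mul_neg, mul_inv_cancel₀ hb, map_neg, map_one]
      have e1 := congrArg (fun F => C β * F) (hu j)
      simp only [huG, c, mul_add, Finset.mul_sum] at e1
      rw [e1]
      have e2 : ∀ F : MvPowerSeries τ K, C β * (C (-β⁻¹) * F) = -F := by
        intro F; rw [← mul_assoc, hββ, neg_one_mul]
      have e3 : ∀ k, C β * (u k * (C (-β⁻¹) * if j = k then b - C β else 0)) =
          if j = k then -((b - C β) * u k) else 0 := by
        intro k
        split_ifs
        · rw [← e2]; ring
        · simp
      have e4 : ∀ k l i, C β * (u k * (C (-β⁻¹) * (u l * (J.adjugate j i * subst V (h i k l))))) =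
          -(u k * (u l * (J.adjugate j i * subst V (h i k l)))) := by
        intro k l i
        rw [← e2]; ring
      simp only [e2, Finset.sum_add_distrib, Finset.mul_sum, e3, e4,
        Finset.sum_ite_eq, Finset.mem_univ, if_true, Finset.sum_neg_distrib]
      ring
    have h2 : ∑ i, J.adjugate j i * Q i =
        ∑ k, u k * ∑ l, u l * ∑ i, J.adjugate j i * subst V (h i k l) := by
      simp only [hQ, Finset.mul_sum]
      rw [Finset.sum_comm]
      refine Finset.sum_congr rfl fun k _ => ?_
      rw [Finset.sum_comm]
      refine Finset.sum_congr rfl fun l _ => Finset.sum_congr rfl fun i _ => ?_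
      ring
    rw [h2]
    linear_combination h1
  have hexp : ∀ i, subst (fun l => p l + ∑ j, if κ j = l then a * u j else 0) (g i) =
      a ^ 2 * q i + a * ∑ j, J i j * u j + a ^ 2 * Q i := by
    intro i
    rw [hT i p (fun j => a * u j) hp (by simp [hu0]), hg]
    have e1 : ∑ j, a * u j * subst p (pderiv K (κ j) (g i)) = a * ∑ j, J i j * u j := by
      rw [Finset.mul_sum]
      refine Finset.sum_congr rfl fun j _ => ?_
      rw [show subst p (pderiv K (κ j) (g i)) = J i j from rfl]
      ring
    have e2 : ∑ j, ∑ k, a * u j * (a * u k) * subst V (h i j k) = a ^ 2 * Q i := by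
      rw [hQ, Finset.mul_sum]
      refine Finset.sum_congr rfl fun j _ => ?_
      rw [Finset.mul_sum]
      exact Finset.sum_congr rfl fun k _ => by ring
    rw [e1, e2]
  refine ⟨u, hu0, ?_, fun j => ?_, ?_⟩
  · obtain ⟨y, hy⟩ : ∃ y : ω → MvPowerSeries τ K, ∀ i, y i =
        subst (fun l => p l + ∑ j, if κ j = l then a * u j else 0) (g i) := ⟨_, fun _ => rfl⟩
    have hadj : J.adjugate.mulVec y = 0 := by
      have hyv : y = a ^ 2 • (fun i => q i + Q i) + a • J.mulVec u := by
        funext i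
        simp only [hy, hexp, Pi.add_apply, Pi.smul_apply, smul_eq_mul, Matrix.mulVec, dotProduct]
        ring
      rw [hyv, Matrix.mulVec_add, Matrix.mulVec_smul, Matrix.mulVec_smul, Matrix.mulVec_mulVec,
        Matrix.adjugate_mul, Matrix.smul_mulVec, Matrix.one_mulVec, hJ]
      funext j
      have := hbr j
      simp only [Pi.add_apply, Pi.smul_apply, smul_eq_mul, Matrix.mulVec, dotProduct, mul_add,
        Finset.sum_add_distrib, Pi.zero_apply]
      linear_combination a ^ 2 * this
    -- Multiplying back by `J` recovers `y = 0`, since `det J = a * b` is nonzero in a domain.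
    have hdet : J.det • y = 0 := by
      have := congrArg J.mulVec hadj
      rwa [Matrix.mulVec_mulVec, Matrix.mul_adjugate, Matrix.smul_mulVec, Matrix.one_mulVec,
        Matrix.mulVec_zero] at this
    intro i
    rw [← hy]
    have := congrFun hdet i
    rw [Pi.smul_apply, hJ, smul_eq_mul, Pi.zero_apply] at this
    refine (mul_eq_zero.1 this).resolve_left (mul_ne_zero ha fun h => hb ?_)
    rw [hβ, h, map_zero]
  · refine (Ideal.span_le.2 ?_) (hus j)
    rintro _ ⟨k, rfl⟩
    exact Ideal.mul_mem_left _ _ (sum_mem fun i _ =>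
      Ideal.mul_mem_left _ _ (Ideal.subset_span ⟨i, rfl⟩))
  · intro hgc hpc hac hbc hqc
    have hadjc : ∀ j i, (J.adjugate j i).IsConvergent := isConvergent_adjugate fun i j =>
      ((hgc i).pderiv (κ j)).subst hpc hp
    have hPc : ∀ i, (P i).IsConvergent := by
      rintro (i | i)
      · exact hιc _ (hpc i)
      · exact (hιc _ hac).mul (isConvergent_X _)
    refine huc (fun j => (isConvergent_C _).mul (mem_convergent.1 (sum_mem fun i _ =>
      (hadjc j i).mul (hqc i)))) fun j k => (isConvergent_C _).mul (IsConvergent.add ?_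
        (mem_convergent.1 (sum_mem fun l _ => (isConvergent_X _).mul (mem_convergent.1
          (sum_mem fun i _ => (hιc _ (hadjc j i)).mul ((hTc i (hgc i) k l).subst hPc hP0))))))
    split_ifs
    · exact hιc _ (mem_convergent.1 (sub_mem hbc (isConvergent_C _)))
    · exact zero_mem (convergent _ K)

end Implicit

end MvPowerSeries

namespace MvPowerSeries

/-! ### Restriction to lines -/

section Line

variable {σ : Type*} {K : Type*} [NormedField K]

/-- The line with direction `c`, as a point with coordinates in `K[[T]]`. -/
noncomputable def line (c : σ → K) : σ → MvPowerSeries Unit K := fun i => C (c i) * X ()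

@[simp] lemma constantCoeff_line (c : σ → K) (i : σ) : constantCoeff (line c i) = 0 := by
  simp [line]

lemma mem_wIdeal_iff_X_pow_dvd {σ : Type*} [DecidableEq σ] {i : σ} {k : ℕ}
    {f : MvPowerSeries σ K} : f ∈ wIdeal (Pi.single i 1) k ↔ X i ^ k ∣ f := by
  rw [mem_wIdeal_iff, X_pow_dvd_iff]
  have : ∀ d : σ →₀ ℕ, Finsupp.weight (Pi.single i 1) d = d i := by
    intro d
    rw [Finsupp.weight_apply, Finsupp.sum]
    by_cases hi : d i = 0
    · rw [hi]
      refine Finset.sum_eq_zero fun j _ => ?_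
      by_cases hj : j = i
      · subst hj; simp [hi]
      · simp [hj]
    · rw [Finset.sum_eq_single i]
      · simp
      · intro j _ hj; simp [hj]
      · intro h; simp at h; contradiction
  simp only [this]

lemma mem_wIdeal_one_of_unit {k : ℕ} {f : MvPowerSeries Unit K}
    (hf : f ∈ wIdeal (fun _ => 1) k) : X () ^ k ∣ f := by
  rw [← mem_wIdeal_iff_X_pow_dvd]
  convert hf using 2
  funext i
  simp

lemma weight_one_eq_degree (d : σ →₀ ℕ) : Finsupp.weight (fun _ => 1) d = d.degree := by
  rw [Finsupp.degree_eq_weight_one]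

lemma subst_mem_wIdeal {τ : Type*} [Finite σ] {a : σ → MvPowerSeries τ K}
    (ha : ∀ i, constantCoeff (a i) = 0) {k : ℕ} {f : MvPowerSeries σ K}
    (hf : f ∈ wIdeal (fun _ => 1) k) : subst a f ∈ wIdeal (fun _ => 1) k := by
  rw [mem_wIdeal_iff]
  intro d hd
  rw [coeff_subst (hasSubst_of_constantCoeff_zero ha)]
  refine finsum_eq_zero_of_forall_eq_zero fun e => ?_
  by_cases he : Finsupp.weight (fun _ => 1) e < k
  · rw [mem_wIdeal_iff.1 hf e he, zero_smul]
  · have h2 : ∀ n i, a i ^ n ∈ (wIdeal (fun _ => 1) n : Ideal (MvPowerSeries τ K)) := by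
      intro n i
      induction n with
      | zero => exact mem_wIdeal_zero _ _
      | succ n ih =>
        rw [pow_succ]
        exact mul_mem_wIdeal ih (mem_wIdeal_one_iff.2 (ha i))
    have h3 : ∀ s : Finset σ, (∏ i ∈ s, a i ^ e i) ∈
        (wIdeal (fun _ => 1) (∑ i ∈ s, e i) : Ideal (MvPowerSeries τ K)) := by
      classical
      intro s
      induction s using Finset.induction_on with
      | empty => exact mem_wIdeal_zero _ _
      | insert i s hi ih =>
        rw [Finset.prod_insert hi, Finset.sum_insert hi]
        exact mul_mem_wIdeal (h2 _ _) ih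
    have h4 := h3 e.support
    rw [← Finsupp.degree_apply, ← weight_one_eq_degree] at h4
    rw [Finsupp.prod, mem_wIdeal_iff.1 h4 d (by omega), smul_zero]

/-- As `h` has order at least `e`, its truncation is its form of degree `e`. On the line this form
becomes its value at `c` times `T ^ e`, and all other terms are divisible by `T ^ (e + 1)`. -/
lemma exists_subst_line_eq [Fintype σ] (c : σ → K) {e : ℕ} {h : MvPowerSeries σ K}
    (hh : h ∈ wIdeal (fun _ => 1) e) :
    ∃ v, subst (line c) h = X () ^ e * v ∧
      constantCoeff v = MvPolynomial.eval c (truncTotal (e + 1) h) := by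
  classical
  have hl : HasSubst (line c) := hasSubst_of_constantCoeff_zero (constantCoeff_line c)
  set P := truncTotal (e + 1) h with hP
  have hhom : ∀ d ∈ P.support, ∑ i, d i = e := by
    intro d hd
    rw [MvPolynomial.mem_support_iff] at hd
    have h1 : d.degree < e + 1 := by
      by_contra hlt
      exact hd (coeff_truncTotal_eq_zero _ (not_lt.1 hlt))
    rw [hP, coeff_truncTotal _ h1] at hd
    have h2 : ¬ Finsupp.weight (fun _ => 1) d < e := fun hlt => hd (mem_wIdeal_iff.1 hh d hlt)
    rw [weight_one_eq_degree] at h2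
    rw [← Finsupp.degree_eq_sum]
    omega
  have hrem : h - (P : MvPowerSeries σ K) ∈ wIdeal (fun _ => 1) (e + 1) := by
    rw [mem_wIdeal_iff]
    intro d hd
    rw [weight_one_eq_degree] at hd
    rw [map_sub, MvPolynomial.coeff_coe, hP, coeff_truncTotal _ hd, sub_self]
  obtain ⟨v', hv'⟩ := mem_wIdeal_one_of_unit (subst_mem_wIdeal (constantCoeff_line c) hrem)
  have hpoly : subst (line c) (P : MvPowerSeries σ K) =
      X () ^ e * C (MvPolynomial.eval c P) := by
    rw [subst_coe, MvPolynomial.aeval_def, MvPolynomial.eval₂_eq', MvPolynomial.eval_eq', map_sum,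
      Finset.mul_sum]
    refine Finset.sum_congr rfl fun d hd => ?_
    rw [← c_eq_algebraMap]
    simp only [line, mul_pow, Finset.prod_mul_distrib, Finset.prod_pow_eq_pow_sum, hhom d hd,
      map_mul, map_prod, map_pow]
    ring
  refine ⟨C (MvPolynomial.eval c P) + X () * v', ?_, by simp⟩
  have : h = (P : MvPowerSeries σ K) + (h - P) := by ring
  rw [this, subst_add hl, hpoly, hv']
  ring

lemma mem_wIdeal_order [Finite σ] {f : MvPowerSeries σ K} (hf : f ≠ 0) :
    f ∈ wIdeal (fun _ => 1) f.order.toNat ∧ truncTotal (f.order.toNat + 1) f ≠ 0 := by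
  cases nonempty_fintype σ
  have h := ne_zero_iff_order_finite.1 hf
  refine ⟨mem_wIdeal.2 h.le, fun h0 => ?_⟩
  obtain ⟨d, hd, hd'⟩ := exists_coeff_ne_zero_and_order h
  have := congrArg (MvPolynomial.coeff d) h0
  rw [coeff_truncTotal] at this
  · exact hd (by simpa using this)
  · have : ((d.degree : ℕ) : ℕ∞) = f.order.toNat := by rw [h]; exact hd'
    have := Nat.cast_injective this
    omega

/-- Two nonzero power series keep their orders on a suitable line. -/
theorem exists_line [Fintype σ] [Infinite K] {f g : MvPowerSeries σ K} (hf : f ≠ 0) (hg : g ≠ 0) :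
    ∃ (c : σ → K) (v v' : MvPowerSeries Unit K), constantCoeff v ≠ 0 ∧ constantCoeff v' ≠ 0 ∧
      subst (line c) f = X () ^ f.order.toNat * v ∧
      subst (line c) g = X () ^ g.order.toNat * v' := by
  obtain ⟨hf1, hf2⟩ := mem_wIdeal_order hf
  obtain ⟨hg1, hg2⟩ := mem_wIdeal_order hg
  -- Over an infinite field the product of the two leading forms is nonzero at some point.
  obtain ⟨c, hc⟩ : ∃ c : σ → K, MvPolynomial.eval c
      (truncTotal (f.order.toNat + 1) f * truncTotal (g.order.toNat + 1) g) ≠ 0 := by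
    by_contra! hcon
    refine mul_ne_zero hf2 hg2 (MvPolynomial.funext fun x => ?_)
    rw [hcon x, map_zero]
  rw [map_mul] at hc
  obtain ⟨v, hv, hv'⟩ := exists_subst_line_eq c hf1
  obtain ⟨w, hw, hw'⟩ := exists_subst_line_eq c hg1
  exact ⟨c, v, w, hv' ▸ left_ne_zero_of_mul hc, hw' ▸ right_ne_zero_of_mul hc, hv, hw⟩

end Line

end MvPowerSeries

namespace MvPowerSeries

/-! ### Solutions of `g = 0` near `ybar` satisfy all its relations -/

section Uniqueness

variable {σ τ ι ω : Type*} {K : Type*} [NormedField K]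

/-- The Jacobian matrix of the series `g` in the variables `κ`. -/
noncomputable def jac {ν ω ω' : Type*} (g : ω → MvPowerSeries ν K) (κ : ω' → ν) :
    Matrix ω ω' (MvPowerSeries ν K) := Matrix.of fun i j => pderiv K (κ j) (g i)

lemma subst_det [Fintype ω] [DecidableEq ω] {a : σ → MvPowerSeries τ K} (ha : HasSubst a)
    (A : Matrix ω ω (MvPowerSeries σ K)) : subst a A.det = (A.map (subst a)).det := by
  rw [← coe_substAlgHom ha, ← AlgHom.coe_toRingHom, RingHom.map_det]
  rfl

/-- Characteristic zero is needed here: a coefficient is recovered from the derivative by dividing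
by its exponent. -/
lemma mem_wIdeal_succ_of_pderiv [DecidableEq τ] [CharZero K] {i : τ} {k : ℕ}
    {F : MvPowerSeries τ K} (h0 : F ∈ wIdeal (Pi.single i 1) 1)
    (h : pderiv K i F ∈ wIdeal (Pi.single i 1) k) : F ∈ wIdeal (Pi.single i 1) (k + 1) := by
  rw [mem_wIdeal_iff_X_pow_dvd, X_pow_dvd_iff] at *
  intro d hd
  by_cases hdi : d i = 0
  · exact h0 d (by omega)
  · have hle : Finsupp.single i 1 ≤ d := Finsupp.single_le_iff.2 (by omega)
    have h1 := h (d - Finsupp.single i 1) (by simp; omega)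
    rw [coeff_pderiv, tsub_add_cancel_of_le hle] at h1
    exact (mul_eq_zero.1 h1).resolve_right (Nat.cast_add_one_ne_zero _)

/-- Along a path on which `g` vanishes, the derivative of `f` is a combination of the Jacobian
determinants of `(g, f)`. -/
theorem subst_det_jac_mul_derivation [Fintype σ] [Fintype ι] [Fintype ω] [DecidableEq ω]
    (g : ω → MvPowerSeries (σ ⊕ ι) K) (κ : ω → σ ⊕ ι) (f : MvPowerSeries (σ ⊕ ι) K)
    {P : σ ⊕ ι → MvPowerSeries τ K} (hP : ∀ l, constantCoeff (P l) = 0)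
    (D : Derivation K (MvPowerSeries τ K) (MvPowerSeries τ K)) (hD : ∀ i, D (P (Sum.inl i)) = 0)
    (hg : ∀ k, subst P (g k) = 0) :
    subst P (jac g κ).det * D (subst P f) = ∑ i, D (P (Sum.inr i)) *
      subst P (jac (Sum.elim g fun _ : Unit => f) (Sum.elim κ fun _ : Unit => Sum.inr i)).det := by
  classical
  have hs : HasSubst P := hasSubst_of_constantCoeff_zero hP
  have hchain : ∀ h, D (subst P h) = ∑ i, D (P (Sum.inr i)) * subst P (pderiv K (Sum.inr i) h) := by
    intro h
    rw [derivation_subst hP, Fintype.sum_sum_type]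
    simp only [hD, mul_zero, Finset.sum_const_zero, zero_add]
    exact Finset.sum_congr rfl fun i _ => mul_comm _ _
  -- The bordered Jacobian with its last column left empty. By the chain rule the columns `v i`,
  -- weighted by `D (P (inr i))`, add up to `(0, D (f(P)))`. The determinant is linear in the last
  -- column, and for this sum it is block triangular.
  set A : Matrix (ω ⊕ Unit) (ω ⊕ Unit) (MvPowerSeries τ K) :=
    Matrix.fromBlocks ((jac g κ).map (subst P)) 0
      (Matrix.of fun _ j => subst P (pderiv K (κ j) f)) 0 with hA
  let v : ι → ω ⊕ Unit → MvPowerSeries τ K := fun i =>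
    Sum.elim (fun k => subst P (pderiv K (Sum.inr i) (g k)))
      fun _ => subst P (pderiv K (Sum.inr i) f)
  have h1 : ∀ i, subst P (jac (Sum.elim g fun _ : Unit => f)
      (Sum.elim κ fun _ : Unit => Sum.inr i)).det = Matrix.cramer A (v i) (Sum.inr ()) := by
    intro i
    rw [subst_det hs, Matrix.cramer_apply]
    congr 1
    ext (j | j) (l | l) <;> simp [jac, A, v]
  have h2 : ∑ i, D (P (Sum.inr i)) • v i = Sum.elim (0 : ω → MvPowerSeries τ K) fun _ => D (subst P f) := by
    funext l
    rw [Finset.sum_apply]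
    rcases l with k | u
    · have := hchain (g k)
      rw [hg, map_zero] at this
      simpa [v] using this.symm
    · simpa [v] using (hchain f).symm
  have h3 : Matrix.cramer A (Sum.elim (0 : ω → MvPowerSeries τ K) fun _ => D (subst P f)) (Sum.inr ()) =
      subst P (jac g κ).det * D (subst P f) := by
    rw [subst_det hs, Matrix.cramer_apply]
    have : A.updateCol (Sum.inr ()) (Sum.elim (0 : ω → MvPowerSeries τ K) fun _ => D (subst P f)) =
        Matrix.fromBlocks ((jac g κ).map (subst P)) 0
          (Matrix.of fun _ j => subst P (pderiv K (κ j) f))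
          (Matrix.of fun _ _ => D (subst P f)) := by
      ext (j | j) (l | l) <;> simp [A]
    rw [this, Matrix.det_fromBlocks_zero₁₂]
    simp
  rw [← h3, ← h2, map_sum, Finset.sum_apply]
  refine Finset.sum_congr rfl fun i _ => ?_
  rw [map_smul, h1]
  rfl

/-- Near a formal solution `ybar` the equations `g = 0`, taken from a maximal nonvanishing minor,
imply all convergent relations of `ybar`. -/
theorem subst_eq_zero_of_close [CharZero K] [Fintype σ] [Fintype ι] [Fintype ω] [DecidableEq ω]
    (ybar : ι → MvPowerSeries σ K) (hybar : ∀ i, constantCoeff (ybar i) = 0)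
    (g : ω → MvPowerSeries (σ ⊕ ι) K) (κ : ω → ι) (hgc : ∀ k, (g k).IsConvergent)
    (hg : ∀ k, subst (Sum.elim X ybar) (g k) = 0)
    (hδ : subst (Sum.elim X ybar) (jac g (Sum.inr ∘ κ)).det ≠ 0)
    (hmax : ∀ f : MvPowerSeries (σ ⊕ ι) K, f.IsConvergent → subst (Sum.elim X ybar) f = 0 →
      ∀ i, subst (Sum.elim X ybar) (jac (Sum.elim g fun _ : Unit => f)
        (Sum.elim (Sum.inr ∘ κ) fun _ : Unit => Sum.inr i)).det = 0)
    (y : ι → MvPowerSeries σ K) (hy : ∀ i, constantCoeff (y i) = 0)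
    (hclose : ∀ i, y i - ybar i ∈ wIdeal (fun _ => 1)
      (2 * (subst (Sum.elim X ybar) (jac g (Sum.inr ∘ κ)).det).order.toNat + 1))
    (hgy : ∀ k, subst (Sum.elim X y) (g k) = 0) (f : MvPowerSeries (σ ⊕ ι) K)
    (hfc : f.IsConvergent) (hf : subst (Sum.elim X ybar) f = 0) : subst (Sum.elim X y) f = 0 := by
  classical
  by_contra hne
  set δ := subst (Sum.elim X ybar) (jac g (Sum.inr ∘ κ)).det with hδdef
  set e := δ.order.toNat with he
  -- It suffices to work on a line where `δ` and the supposedly nonzero `f(x, y)` both keep their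
  -- orders, hence stay nonzero.
  obtain ⟨c, v, v', hv, hv', hLδ, hLf⟩ := exists_line hδ hne
  have hX0 : ∀ z : ι → MvPowerSeries σ K, (∀ i, constantCoeff (z i) = 0) →
      ∀ l, constantCoeff (Sum.elim X z l : MvPowerSeries σ K) = 0 := by
    rintro z hz (l | l) <;> simp [hz]
  have hys := hasSubst_of_constantCoeff_zero (hX0 ybar hybar)
  have hys' := hasSubst_of_constantCoeff_zero (hX0 y hy)
  have hls : HasSubst (line c) := hasSubst_of_constantCoeff_zero (constantCoeff_line c)
  -- the difference `y - ybar` along the line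
  have hw : ∀ i, ∃ w, subst (line c) (y i) = subst (line c) (ybar i) +
      X () * subst (line c) δ ^ 2 * w := by
    intro i
    obtain ⟨w, hw⟩ := mem_wIdeal_one_of_unit
      (subst_mem_wIdeal (constantCoeff_line c) (hclose i))
    -- Closeness of order `2 * e + 1` leaves one factor `T` besides `δ ^ 2`; this factor is replaced
    -- by a new variable `s` below.
    refine ⟨(v⁻¹) ^ 2 * w, ?_⟩
    have h1 : y i = ybar i + (y i - ybar i) := by ring
    rw [h1, subst_add hls, hw, hLδ]
    have h2 : v * v⁻¹ = 1 := MvPowerSeries.mul_inv_cancel v hv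
    have h3 : X () * (X () ^ e * v) ^ 2 * (v⁻¹ ^ 2 * w) =
      X () ^ (2 * e + 1) * (v * v⁻¹) ^ 2 * w := by ring
    rw [h3, h2, one_pow, mul_one]
  choose w hw using hw
  -- the plane `K[[t, s]]`
  let α : Unit → MvPowerSeries (Fin 2) K := fun _ => X 0
  -- `β` restricts to the diagonal `s = t`, and `γ` to the axis `s = 0`.
  let β : Fin 2 → MvPowerSeries Unit K := fun _ => X ()
  let γ : Fin 2 → MvPowerSeries Unit K := ![X (), 0]
  have hα : HasSubst α := hasSubst_of_constantCoeff_zero (by simp [α])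
  have hβ : HasSubst β := hasSubst_of_constantCoeff_zero (by simp [β])
  have hγ : HasSubst γ := hasSubst_of_constantCoeff_zero (by
    intro i; fin_cases i <;> simp [γ])
  have hβα : ∀ F : MvPowerSeries Unit K, subst β (subst α F) = F := by
    intro F
    rw [subst_subst hα hβ]
    simp only [α, subst_X hβ]
    exact congrFun subst_self F
  have hγα : ∀ F : MvPowerSeries Unit K, subst γ (subst α F) = F := by
    intro F
    rw [subst_subst hα hγ]
    simp only [α, subst_X hγ]
    exact congrFun subst_self F
  set a : MvPowerSeries (Fin 2) K := subst α (subst (line c) δ) with ha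
  set p₀ : σ ⊕ ι → MvPowerSeries (Fin 2) K :=
    Sum.elim (fun i => C (c i) * X 0) fun i => subst α (subst (line c) (ybar i)) with hp₀
  -- A path from `ybar` at `s = 0` to `y` at `s = t`.
  set p : σ ⊕ ι → MvPowerSeries (Fin 2) K :=
    Sum.elim (fun i => C (c i) * X 0)
      fun i => subst α (subst (line c) (ybar i)) + X 1 * a ^ 2 * subst α (w i) with hp
  have hp₀0 : ∀ l, constantCoeff (p₀ l) = 0 := by
    rintro (l | l)
    · simp [hp₀]
    · simp only [hp₀, Sum.elim_inr]
      rw [constantCoeff_subst_zero (by simp [α]), constantCoeff_subst_zero (constantCoeff_line c),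
        hybar]
  have hp0 : ∀ l, constantCoeff (p l) = 0 := by
    rintro (l | l)
    · simp [hp]
    · have := hp₀0 (Sum.inr l)
      simp only [hp₀, Sum.elim_inr] at this
      simp [hp, this]
  have hps : HasSubst p := hasSubst_of_constantCoeff_zero hp0
  have hp₀s : HasSubst p₀ := hasSubst_of_constantCoeff_zero hp₀0
  have hp₀eq : ∀ F : MvPowerSeries (σ ⊕ ι) K, subst p₀ F = subst α (subst (line c) (subst (Sum.elim X ybar) F)) := by
    intro F
    rw [subst_subst hys hls, subst_subst (hasSubst_of_constantCoeff_zero ?_) hα]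
    · congr 1
      funext l
      rcases l with l | l
      · simp only [hp₀, Sum.elim_inl, subst_X hls, line, subst_mul hα, subst_C', subst_X hα, α]
      · rfl
    · rintro (l | l)
      · simp [subst_X hls]
      · simp [constantCoeff_subst_zero, hybar]
  have hpp₀ : ∀ F : MvPowerSeries (σ ⊕ ι) K, ∃ q, subst p F = subst p₀ F + a ^ 2 * (X 1 * q) := by
    intro F
    have h1 := subst_sub_subst_mem hp0 hp₀0 (Ideal.span {X 1 * a ^ 2}) (by
      rintro (l | l)
      · simp [hp, hp₀]
      · simp only [hp, hp₀, Sum.elim_inr, add_sub_cancel_left]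
        exact Ideal.mul_mem_right _ _ (Ideal.mem_span_singleton_self _)) F
    obtain ⟨q, hq⟩ := Ideal.mem_span_singleton'.1 h1
    exact ⟨q, by linear_combination -hq⟩
  choose r hr using hpp₀
  have hX : (X () : MvPowerSeries Unit K) ≠ 0 := by
    intro h
    have := congrArg (coeff (Finsupp.single () 1)) h
    simp at this
  have hLδ0 : subst (line c) δ ≠ 0 := by
    rw [hLδ]
    refine mul_ne_zero (pow_ne_zero _ hX) ?_
    rintro rfl
    simp at hv
  have hLf0 : subst (line c) (subst (Sum.elim X y) f) ≠ 0 := by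
    rw [hLf]
    refine mul_ne_zero (pow_ne_zero _ hX) ?_
    rintro rfl
    simp at hv'
  have hγa : subst γ a ≠ 0 := by
    rw [ha, hγα]
    exact hLδ0
  have ha0 : a ≠ 0 := by
    intro h0
    rw [h0, subst_zero' hγ] at hγa
    exact hγa rfl
  have hJ : (Matrix.of fun i j => subst p (pderiv K ((Sum.inr ∘ κ) j) (g i))).det =
      a * (1 + a * (X 1 * r (jac g (Sum.inr ∘ κ)).det)) := by
    have h1 := hr (jac g (Sum.inr ∘ κ)).det
    rw [subst_det hps, hp₀eq, ← hδdef, ← ha] at h1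
    refine Eq.trans h1 ?_
    ring
  -- Since `g(p) = a² * (s * r)`, the path can be corrected to lie in `g = 0`. The correction lies
  -- in the ideal of the errors `s * r`, so it vanishes wherever they do, in particular at `s = 0`.
  obtain ⟨u, hu0, hu, hus, -⟩ := exists_tougeron g (Sum.inr ∘ κ) p hp0 a _
    (fun k => X 1 * r (g k)) hJ ha0 (by simp)
    (fun k => by rw [hr, hp₀eq, hg, subst_zero' hls, subst_zero' hα, zero_add]) (by simp)
  set P : σ ⊕ ι → MvPowerSeries (Fin 2) K :=
    fun l => p l + ∑ j, if (Sum.inr ∘ κ) j = l then a * u j else 0 with hPdef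
  have hP0 : ∀ l, constantCoeff (P l) = 0 := by
    intro l
    simp only [hPdef, map_add, map_sum, hp0, zero_add]
    exact Finset.sum_eq_zero fun j _ => by split_ifs <;> simp [hu0]
  have hPs : HasSubst P := hasSubst_of_constantCoeff_zero hP0
  have hPl : ∀ i, P (Sum.inl i) = C (c i) * X 0 := by
    intro i
    simp [hPdef, hp]
  have hu1 : ∀ j, u j ∈ Ideal.span {(X 1 : MvPowerSeries (Fin 2) K)} := by
    intro j
    refine Ideal.span_le.2 ?_ (hus j)
    rintro _ ⟨k, rfl⟩
    exact Ideal.mul_mem_right _ _ (Ideal.mem_span_singleton_self _)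
  have hspan : ∀ F : MvPowerSeries (Fin 2) K, F ∈ Ideal.span {(X 1 : MvPowerSeries (Fin 2) K)} ↔
      F ∈ wIdeal (Pi.single 1 1) 1 := by
    intro F
    rw [mem_wIdeal_iff_X_pow_dvd, pow_one, Ideal.mem_span_singleton]
  have hPF : ∀ F : MvPowerSeries (σ ⊕ ι) K, subst P F - subst p₀ F ∈ wIdeal (Pi.single 1 1) 1 := by
    intro F
    rw [← hspan]
    refine subst_sub_subst_mem hP0 hp₀0 _ ?_ F
    rintro (l | l)
    · rw [hPl]; simp [hp₀]
    · have : P (Sum.inr l) - p₀ (Sum.inr l) = X 1 * a ^ 2 * subst α (w l) +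
          ∑ j, if (Sum.inr ∘ κ) j = (Sum.inr l : σ ⊕ ι) then a * u j else 0 := by
        simp only [hPdef, hp, hp₀, Sum.elim_inr]
        ring
      rw [this]
      refine add_mem (Ideal.mul_mem_right _ _ (Ideal.mul_mem_right _ _
        (Ideal.mem_span_singleton_self _))) (sum_mem fun j _ => ?_)
      split_ifs
      · exact Ideal.mul_mem_left _ _ (hu1 j)
      · exact zero_mem _
  -- At `s = 0` this is `δ` on the line, which is nonzero; so `δ(P)` can be cancelled in orders with
  -- respect to `s`.
  have hδP : subst P (jac g (Sum.inr ∘ κ)).det ∉ wIdeal (Pi.single 1 1) 1 := by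
    intro hmem
    have h1 := sub_mem hmem (hPF (jac g (Sum.inr ∘ κ)).det)
    rw [sub_sub_cancel, hp₀eq, ← hδdef, ← ha, mem_wIdeal_iff_X_pow_dvd, pow_one] at h1
    obtain ⟨b, hb⟩ := h1
    apply hγa
    rw [hb, subst_mul hγ, subst_X hγ]
    simp [γ]
  have hδP' : weightedOrder (Pi.single 1 1) (subst P (jac g (Sum.inr ∘ κ)).det) = 0 := by
    by_contra h
    exact hδP (mem_wIdeal.2 (by exact_mod_cast Order.one_le_iff_ne_zero.2 h))
  -- The induction runs over all convergent relations `F` of `ybar` at once: `δ(P) * ∂F(P)/∂s` is a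
  -- combination of bordered minors at `P`, which are relations of `ybar` by `hmax` and so fall
  -- under `ih`.
  have hvan : ∀ k, ∀ F : MvPowerSeries (σ ⊕ ι) K, F.IsConvergent →
      subst (Sum.elim X ybar) F = 0 → subst P F ∈ wIdeal (Pi.single 1 1) k := by
    intro k
    induction k with
    | zero => exact fun F _ _ => mem_wIdeal_zero _ _
    | succ k ih =>
      intro F hFc hF
      refine mem_wIdeal_succ_of_pderiv ?_ ?_
      · have := hPF F
        rwa [hp₀eq, hF, subst_zero' hls, subst_zero' hα, sub_zero] at this
      · have h1 := subst_det_jac_mul_derivation g (Sum.inr ∘ κ) F hP0 (pderiv K (1 : Fin 2))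
          (by
            intro i
            rw [hPl]
            simp [Derivation.leibniz, pderiv_X_of_ne, pderiv_C]) hu
        have h2 : subst P (jac g (Sum.inr ∘ κ)).det * pderiv K 1 (subst P F) ∈
            wIdeal (Pi.single 1 1) k := by
          rw [h1]
          refine sum_mem fun i _ => Ideal.mul_mem_left _ _ (ih _ ?_ (hmax F hFc hF i))
          refine isConvergent_det fun k l => ?_
          rcases k with k | k
          · exact (hgc k).pderiv _
          · exact hFc.pderiv _
        rw [mem_wIdeal, weightedOrder_mul, hδP', zero_add] at h2
        exact h2
  have hPf : subst P f = 0 := eq_zero_of_forall_mem_wIdeal fun k => hvan k f hfc hf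
  -- restriction to the diagonal
  have hβp : ∀ F : MvPowerSeries (σ ⊕ ι) K, subst β (subst p F) = subst (line c) (subst (Sum.elim X y) F) := by
    intro F
    rw [subst_subst hps hβ, subst_subst hys' hls]
    congr 1
    funext l
    rcases l with l | l
    · simp [hp, subst_mul hβ, subst_X hβ, β, subst_X hls, line]
    · simp only [hp, ha, Sum.elim_inr, subst_add hβ, subst_mul hβ, subst_pow hβ, hβα, subst_X hβ, hw]
      rfl
  have hβa : subst β a = subst (line c) δ := hβα _
  -- On the diagonal `p` is `y`, where `g` vanishes. Hence the errors and the correction `u` vanish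
  -- there, and `P` restricts to `y` too.
  have hβq : ∀ k, subst β (X 1 * r (g k)) = 0 := by
    intro k
    have h1 := congrArg (subst β) (hr (g k))
    rw [hβp, hgy, subst_zero' hls, hp₀eq, hg, subst_zero' hls, subst_zero' hα, zero_add,
      subst_mul hβ, subst_pow hβ, hβa] at h1
    exact (mul_eq_zero.1 h1.symm).resolve_left (pow_ne_zero _ hLδ0)
  have hβu : ∀ j, subst β (u j) = 0 := by
    intro j
    have : Ideal.span (Set.range fun k => X 1 * r (g k)) ≤
        RingHom.ker (substAlgHom (R := K) hβ).toRingHom := by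
      rw [Ideal.span_le]
      rintro _ ⟨k, rfl⟩
      have := hβq k
      rw [← coe_substAlgHom hβ] at this
      exact this
    have h1 := this (hus j)
    rw [← coe_substAlgHom hβ]
    exact h1
  apply hLf0
  rw [← hβp, ← subst_zero' (σ := Fin 2) hβ, ← hPf, subst_subst hps hβ, subst_subst hPs hβ]
  congr 1
  funext l
  simp only [hPdef, subst_add hβ, subst_sum hβ]
  rw [Finset.sum_eq_zero, add_zero]
  intro j _
  split_ifs
  · rw [subst_mul hβ, hβu, mul_zero]
  · exact subst_zero' hβ

end Uniqueness

end MvPowerSeries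

namespace MvPowerSeries

/-! ### Choice of a maximal Jacobian minor -/

section Minor

variable {σ ι : Type*} {K : Type*} [NormedField K]

/-- Among the convergent relations of `ybar` there is a system with a nonvanishing Jacobian minor
which is maximal with this property. -/
theorem exists_maximal_minor [Finite σ] [Fintype ι] (ybar : ι → MvPowerSeries σ K)
    (hybar : ∀ i, constantCoeff (ybar i) = 0) :
    ∃ (ω : Type) (_ : Fintype ω) (_ : DecidableEq ω) (g : ω → MvPowerSeries (σ ⊕ ι) K) (κ : ω → ι),
      (∀ k, (g k).IsConvergent) ∧ (∀ k, subst (Sum.elim X ybar) (g k) = 0) ∧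
      subst (Sum.elim X ybar) (jac g (Sum.inr ∘ κ)).det ≠ 0 ∧
      ∀ f : MvPowerSeries (σ ⊕ ι) K, f.IsConvergent → subst (Sum.elim X ybar) f = 0 →
        ∀ i, subst (Sum.elim X ybar) (jac (Sum.elim g fun _ : Unit => f)
          (Sum.elim (Sum.inr ∘ κ) fun _ : Unit => Sum.inr i)).det = 0 := by
  classical
  have hs : HasSubst (Sum.elim X ybar) := hasSubst_of_constantCoeff_zero (by
    rintro (l | l) <;> simp [hybar])
  let Q : ℕ → Prop := fun n => ∃ (ω : Type) (_ : Fintype ω) (_ : DecidableEq ω)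
    (g : ω → MvPowerSeries (σ ⊕ ι) K) (κ : ω → ι), Fintype.card ω = n ∧
      (∀ k, (g k).IsConvergent) ∧ (∀ k, subst (Sum.elim X ybar) (g k) = 0) ∧
      subst (Sum.elim X ybar) (jac g (Sum.inr ∘ κ)).det ≠ 0
  have hQ0 : Q 0 := by
    refine ⟨Empty, inferInstance, inferInstance, Empty.elim, Empty.elim, rfl, by simp, by simp, ?_⟩
    rw [Matrix.det_isEmpty, ← coe_substAlgHom hs, map_one]
    exact one_ne_zero
  -- A repeated variable gives two equal columns, so `κ` is injective.
  have hbound : ∀ n, Q n → n ≤ Fintype.card ι := by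
    rintro n ⟨ω, _, _, g, κ, rfl, -, -, hdet⟩
    refine Fintype.card_le_of_injective κ fun j l hjl => ?_
    by_contra hne
    apply hdet
    rw [Matrix.det_zero_of_column_eq hne (fun k => by simp [jac, hjl]), subst_zero' hs]
  obtain ⟨ω, i1, i2, g, κ, hcard, hgc, hg, hdet⟩ := Nat.findGreatest_spec (P := Q)
    (Nat.zero_le (Fintype.card ι)) hQ0
  refine ⟨ω, i1, i2, g, κ, hgc, hg, hdet, fun f hfc hf i => ?_⟩
  by_contra hne
  have hQ : Q (Fintype.card ω + 1) := by
    refine ⟨ω ⊕ Unit, inferInstance, inferInstance, Sum.elim g fun _ => f,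
      Sum.elim κ fun _ => i, by simp, ?_, ?_, ?_⟩
    · rintro (k | k)
      · exact hgc k
      · exact hfc
    · rintro (k | k)
      · exact hg k
      · exact hf
    · convert hne using 4
      funext k
      rcases k with k | k <;> rfl
  have := Nat.le_findGreatest (hbound _ hQ) hQ
  omega

end Minor

end MvPowerSeries

namespace MvPowerSeries

/-! ### Weierstrass division and preparation -/

section Weierstrass

variable {τ : Type*} {K : Type*} [NormedField K]

/-- The weights that count the degree in all variables but the distinguished one. -/
def optWeight (τ : Type*) : Option τ → ℕ := fun o => o.elim 0 fun _ => 1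

/-- The quotient of the division by the `k`-th power of the distinguished variable. -/
noncomputable def divXPow (k : ℕ) (F : MvPowerSeries (Option τ) K) : MvPowerSeries (Option τ) K :=
  fun d => coeff (d + Finsupp.single none k) F

/-- A power series in the variables `τ`, viewed in `Option τ`. -/
noncomputable def incl (f : MvPowerSeries τ K) : MvPowerSeries (Option τ) K :=
  rename Function.Embedding.some f

lemma coeff_divXPow (k : ℕ) (F : MvPowerSeries (Option τ) K) (d : Option τ →₀ ℕ) :
    coeff d (divXPow k F) = coeff (d + Finsupp.single none k) F := rfl

lemma divXPow_add (k : ℕ) (F G : MvPowerSeries (Option τ) K) :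
    divXPow k (F + G) = divXPow k F + divXPow k G := by
  ext d; simp [coeff_divXPow]

lemma divXPow_sub (k : ℕ) (F G : MvPowerSeries (Option τ) K) :
    divXPow k (F - G) = divXPow k F - divXPow k G := by
  ext d; simp [coeff_divXPow]

lemma divXPow_mul_X_pow (k : ℕ) (F : MvPowerSeries (Option τ) K) :
    divXPow k (F * X none ^ k) = F := by
  ext d
  rw [coeff_divXPow, X_pow_eq, coeff_add_mul_monomial, mul_one]

lemma weight_optWeight_eq_zero_iff {d : Option τ →₀ ℕ} :
    Finsupp.weight (optWeight τ) d = 0 ↔ d = Finsupp.single none (d none) := by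
  classical
  rw [Finsupp.weight_apply, Finsupp.sum, Finset.sum_eq_zero_iff]
  constructor
  · intro h
    ext i
    rcases i with _ | i
    · simp
    · by_contra hne
      have hne' : d (some i) ≠ 0 := by simpa using hne
      have := h (some i) (Finsupp.mem_support_iff.2 hne')
      simp [optWeight] at this
      exact hne' this
  · intro h i _
    rcases i with _ | i
    · simp [optWeight]
    · rw [h]; simp

lemma weight_optWeight_add_single (d : Option τ →₀ ℕ) (k : ℕ) :
    Finsupp.weight (optWeight τ) (d + Finsupp.single none k) = Finsupp.weight (optWeight τ) d := by
  rw [map_add, Finsupp.weight_apply _ (Finsupp.single none k), Finsupp.sum_single_index] <;>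
    simp [optWeight]

lemma divXPow_mem_wIdeal {k m : ℕ} {F : MvPowerSeries (Option τ) K}
    (hF : F ∈ wIdeal (optWeight τ) m) : divXPow k F ∈ wIdeal (optWeight τ) m := by
  rw [mem_wIdeal_iff] at *
  intro d hd
  rw [coeff_divXPow]
  exact hF _ (by rwa [weight_optWeight_add_single])

lemma mem_wIdeal_optWeight_one_iff {F : MvPowerSeries (Option τ) K} :
    F ∈ wIdeal (optWeight τ) 1 ↔ ∀ j, coeff (Finsupp.single none j) F = 0 := by
  rw [mem_wIdeal_iff]
  constructor
  · intro h j
    refine h _ (Nat.lt_one_iff.2 (weight_optWeight_eq_zero_iff.2 (by simp)))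
  · intro h d hd
    rw [weight_optWeight_eq_zero_iff.1 (Nat.lt_one_iff.1 hd)]
    exact h _

lemma coeff_X_pow_mul_incl (j : ℕ) (f : MvPowerSeries τ K) (d : Option τ →₀ ℕ) :
    coeff d (X none ^ j * incl f) = if d none = j then coeff d.some f else 0 := by
  classical
  rw [X_pow_eq, coeff_monomial_mul]
  split_ifs with h1 h2 h2
  · have : d - Finsupp.single none j = d.some.embDomain Function.Embedding.some := by
      ext i
      rcases i with _ | i
      · rw [Finsupp.embDomain_of_notMem_range _ _ _ (by simp)]
        simp [h2]
      · refine Eq.trans ?_ (Finsupp.embDomain_apply_self Function.Embedding.some d.some i).symm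
        simp
    rw [this, incl, coeff_embDomain_rename, one_mul]
  · rw [incl, coeff_rename_eq_zero, mul_zero]
    rintro ⟨d', hd'⟩
    have h3 := DFunLike.congr_fun hd' none
    rw [Finsupp.mapDomain_of_notMem_range _ _ (by simp)] at h3
    have h4 := Finsupp.single_le_iff.1 h1
    simp at h3
    omega
  · exact absurd (Finsupp.single_le_iff.2 h2.ge) h1
  · rfl

lemma coeff_sum_X_pow_mul_incl {k : ℕ} (R : Fin k → MvPowerSeries τ K) (d : Option τ →₀ ℕ) :
    coeff d (∑ j : Fin k, X none ^ (j : ℕ) * incl (R j)) =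
      if h : d none < k then coeff d.some (R ⟨d none, h⟩) else 0 := by
  rw [map_sum]
  simp only [coeff_X_pow_mul_incl]
  split_ifs with h
  · rw [Finset.sum_eq_single ⟨d none, h⟩]
    · simp
    · intro j _ hj
      rw [if_neg]
      rintro h'
      exact hj (Fin.ext h'.symm)
    · simp
  · refine Finset.sum_eq_zero fun j _ => if_neg fun h' => h (by omega)

lemma divXPow_sum_X_pow_mul_incl {k : ℕ} (R : Fin k → MvPowerSeries τ K) :
    divXPow k (∑ j : Fin k, X none ^ (j : ℕ) * incl (R j)) = 0 := by
  ext d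
  rw [coeff_divXPow, coeff_sum_X_pow_mul_incl, dif_neg (by simp)]
  simp

/-- The hypothesis bounds the degree in the distinguished variable by `k`; the `R j` collect its
coefficients. -/
lemma exists_eq_sum_X_pow_mul_incl {k : ℕ} {F : MvPowerSeries (Option τ) K}
    (hF : divXPow k F = 0) :
    ∃ R : Fin k → MvPowerSeries τ K, F = ∑ j : Fin k, X none ^ (j : ℕ) * incl (R j) ∧
      (F.IsConvergent → ∀ j, (R j).IsConvergent) := by
  let E : ℕ → (τ →₀ ℕ) → Option τ →₀ ℕ :=
    fun j d => d.embDomain Function.Embedding.some + Finsupp.single none j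
  obtain ⟨R, hR⟩ : ∃ R : Fin k → MvPowerSeries τ K, ∀ j d, coeff d (R j) = coeff (E j d) F :=
    ⟨fun j d => coeff (E j d) F, fun _ _ => rfl⟩
  refine ⟨R, ?_, fun hFc j => ?_⟩
  · ext d
    rw [coeff_sum_X_pow_mul_incl]
    split_ifs with h
    · have hE : E (d none) d.some = d := by
        ext i
        rcases i with _ | i
        · simp [E]
        · simp only [E, Finsupp.add_apply, Finsupp.embDomain_some_some]
          simp
      rw [hR]
      exact congrArg (fun e => coeff e F) hE.symm
    · have := congrArg (coeff (d - Finsupp.single none k)) hF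
      rw [coeff_divXPow, tsub_add_cancel_of_le (Finsupp.single_le_iff.2 (not_lt.1 h))] at this
      simpa using this
  · obtain ⟨r, hr, hr'⟩ := isConvergent_iff.1 hFc
    refine isConvergent_iff.2 ⟨r, hr, fun htop => hr' ?_⟩
    have hinj : Function.Injective (E j) := fun a b hab =>
      Finsupp.embDomain_injective _ (add_right_cancel hab)
    have h1 : wnorm (fun _ => r) (R j) * r ^ (j : ℕ) ≤ wnorm (fun _ => r) F := by
      rw [wnorm, ← ENNReal.tsum_mul_right]
      refine le_trans (le_of_eq (tsum_congr fun d => ?_)) (ENNReal.tsum_comp_le_tsum_of_injective hinj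
        (fun d => ‖coeff d F‖ₑ * wt (fun _ => r) d))
      rw [wt_add, wt_single, ← mul_assoc, hR]
      congr 2
      rw [wt, wt, Finsupp.prod_embDomain]
    rw [htop, ENNReal.top_mul (pow_ne_zero _ hr), top_le_iff] at h1
    exact h1

/-- Dropping all powers below `k` yields `Q = -divXPow k (Q * (p - X none ^ k))`. The right side has
higher order in the other variables than `Q`, which forces `Q = 0`. -/
lemma weierstrass_unique {k : ℕ} {p : MvPowerSeries (Option τ) K}
    (hp : p - X none ^ k ∈ wIdeal (optWeight τ) 1) {Q : MvPowerSeries (Option τ) K}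
    {R : Fin k → MvPowerSeries τ K} (h : Q * p = ∑ j : Fin k, X none ^ (j : ℕ) * incl (R j)) :
    Q = 0 ∧ ∀ j, R j = 0 := by
  have h1 : divXPow k (Q * p) = 0 := by rw [h, divXPow_sum_X_pow_mul_incl]
  have h2 : Q = -divXPow k (Q * (p - X none ^ k)) := by
    have : Q * p = Q * X none ^ k + Q * (p - X none ^ k) := by ring
    rw [this, divXPow_add, divXPow_mul_X_pow] at h1
    linear_combination h1
  have hQ : Q = 0 := by
    refine eq_zero_of_forall_mem_wIdeal (w := optWeight τ) fun m => ?_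
    induction m with
    | zero => exact mem_wIdeal_zero _ _
    | succ m ih =>
      rw [h2]
      exact neg_mem (divXPow_mem_wIdeal (mul_mem_wIdeal ih hp))
  refine ⟨hQ, fun j => ?_⟩
  rw [hQ, zero_mul] at h
  ext d
  obtain ⟨D, hD1, hD2⟩ : ∃ D : Option τ →₀ ℕ, D none = (j : ℕ) ∧ D.some = d :=
    ⟨d.optionElim (j : ℕ), by simp, by simp⟩
  have h3 := congrArg (coeff D) h
  rw [coeff_sum_X_pow_mul_incl, dif_pos (by rw [hD1]; exact j.2), hD2] at h3
  simp only [hD1] at h3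
  exact h3.symm

/-- Only the radii of the variables `τ` shrink, and every monomial of `s` contains such a variable.
Thus `s` becomes small while the radius `r` of the distinguished variable stays fixed. -/
lemma wnorm_le_of_mem_wIdeal {t r : ℝ≥0∞} (ht : t ≤ 1) {s : MvPowerSeries (Option τ) K}
    (hs : s ∈ wIdeal (optWeight τ) 1) :
    wnorm (fun o => o.elim r fun _ => t * r) s ≤ t * wnorm (fun _ => r) s := by
  rw [wnorm, wnorm, ← ENNReal.tsum_mul_left]
  refine ENNReal.tsum_le_tsum fun d => ?_
  by_cases hd : Finsupp.weight (optWeight τ) d < 1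
  · rw [mem_wIdeal_iff.1 hs d hd]; simp
  · have h1 : wt (fun o => Option.elim o r fun _ => t * r) d ≤ t * wt (fun _ => r) d := by
      obtain ⟨i, hi⟩ : ∃ i, d (some i) ≠ 0 := by
        by_contra! h
        refine hd (Nat.lt_one_iff.2 (weight_optWeight_eq_zero_iff.2 ?_))
        ext j
        rcases j with _ | j <;> simp [h]
      have h2 : d = (d - Finsupp.single (some i) 1) + Finsupp.single (some i) 1 :=
        (tsub_add_cancel_of_le (Finsupp.single_le_iff.2 (by omega))).symm
      rw [h2, wt_add, wt_add, wt_single, wt_single, pow_one, pow_one]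
      have h3 : wt (fun o => Option.elim o r fun _ => t * r) (d - Finsupp.single (some i) 1) ≤
          wt (fun _ => r) (d - Finsupp.single (some i) 1) := wt_mono (by
        rintro (_ | j)
        · exact le_rfl
        · exact mul_le_of_le_one_left zero_le ht) _
      calc _ ≤ wt (fun _ => r) (d - Finsupp.single (some i) 1) * (t * r) := by
            gcongr; exact le_rfl
        _ = _ := by ring
    calc _ ≤ ‖coeff d s‖ₑ * (t * wt (fun _ => r) d) := by gcongr
      _ = _ := by ring

/-- Weierstrass division by a series which is congruent to a power of the distinguished variable
modulo the other variables. -/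
theorem exists_weierstrass_division [Finite τ] {k : ℕ} {p : MvPowerSeries (Option τ) K}
    (hp : p - X none ^ k ∈ wIdeal (optWeight τ) 1) (F : MvPowerSeries (Option τ) K) :
    ∃ (Q : MvPowerSeries (Option τ) K) (R : Fin k → MvPowerSeries τ K),
      F = Q * p + ∑ j : Fin k, X none ^ (j : ℕ) * incl (R j) ∧
      (F.IsConvergent → p.IsConvergent → Q.IsConvergent ∧ ∀ j, (R j).IsConvergent) := by
  set s := p - X none ^ k with hs
  -- A fixed point `Q` is exactly a quotient for which `F - Q * p` has degree below `k` in the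
  -- distinguished variable.
  let Φ : (Unit → MvPowerSeries (Option τ) K) → Unit → MvPowerSeries (Option τ) K :=
    fun Q _ => divXPow k F - divXPow k (Q () * s)
  have hcon : ∀ u v : Unit → MvPowerSeries (Option τ) K, ∀ m,
      (∀ j, u j - v j ∈ wIdeal (optWeight τ) m) →
      ∀ j, Φ u j - Φ v j ∈ wIdeal (optWeight τ) (m + 1) := by
    intro u v m huv j
    have : Φ u j - Φ v j = -divXPow k ((u () - v ()) * s) := by
      simp only [Φ, sub_mul, divXPow_sub]
      ring
    rw [this]
    exact neg_mem (divXPow_mem_wIdeal (mul_mem_wIdeal (huv ()) hp))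
  have finish : ∀ Q : Unit → MvPowerSeries (Option τ) K, Φ Q = Q →
      ∃ R : Fin k → MvPowerSeries τ K,
        F = Q () * p + ∑ j : Fin k, X none ^ (j : ℕ) * incl (R j) ∧
        (F.IsConvergent → p.IsConvergent → (Q ()).IsConvergent → ∀ j, (R j).IsConvergent) := by
    intro Q hQ
    have h1 : divXPow k (F - Q () * p) = 0 := by
      have h2 : Q () * p = Q () * X none ^ k + Q () * s := by rw [hs]; ring
      have h3 := congrFun hQ ()
      rw [divXPow_sub, h2, divXPow_add, divXPow_mul_X_pow]
      simp only [Φ] at h3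
      linear_combination h3
    obtain ⟨R, hR, hRc⟩ := exists_eq_sum_X_pow_mul_incl h1
    exact ⟨R, by rw [← hR]; ring, fun hF hp hQ => hRc
      (mem_convergent.1 (sub_mem hF (IsConvergent.mul hQ hp)))⟩
  by_cases hc : F.IsConvergent ∧ p.IsConvergent
  · obtain ⟨hFc, hpc⟩ := hc
    have hsc : s.IsConvergent :=
      mem_convergent.1 (sub_mem hpc (pow_mem (mem_convergent.2 (isConvergent_X _)) _))
    obtain ⟨r, hr, hr', hrf⟩ := IsConvergent.exists_radius (ι := Bool)
      (f := fun b => cond b F s) (by rintro (_ | _) <;> assumption)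
    have hFr : wnorm (fun _ => r) F ≠ ∞ := hrf true
    have hsr : wnorm (fun _ => r) s ≠ ∞ := hrf false
    have hrk : r ^ k ≠ 0 := pow_ne_zero _ hr
    have hrk' : r ^ k ≠ ∞ := ENNReal.pow_ne_top hr'
    set M := wnorm (fun _ => r) s with hM
    -- This makes the norm of `s` at most `r ^ k / 2`. As `divXPow k` costs a factor `r ^ (-k)`, the
    -- map `Q ↦ divXPow k (Q * s)` at least halves norms, and the ball of radius `B` below is
    -- preserved.
    set t := min 1 (r ^ k / 2 / M) with ht
    have ht1 : t ≤ 1 := min_le_left _ _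
    have ht0 : t ≠ 0 := by
      intro h
      rcases min_eq_bot.1 h with h | h
      · simp at h
      · rcases ENNReal.div_eq_zero_iff.1 h with h | h
        · rcases ENNReal.div_eq_zero_iff.1 h with h | h
          · exact hrk h
          · simp at h
        · exact hsr h
    set ρ : Option τ → ℝ≥0∞ := fun o => o.elim r fun _ => t * r with hρ
    have hρ0 : ∀ o, ρ o ≠ 0 := by
      rintro (_ | o)
      · exact hr
      · exact mul_ne_zero ht0 hr
    have hρr : ρ ≤ fun _ => r := by
      rintro (_ | o)
      · exact le_rfl
      · exact mul_le_of_le_one_left zero_le ht1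
    have hsρ : wnorm ρ s ≤ r ^ k / 2 := by
      refine (wnorm_le_of_mem_wIdeal ht1 hp).trans ?_
      calc t * M ≤ (r ^ k / 2 / M) * M := by gcongr; exact min_le_right _ _
        _ ≤ _ := by rw [mul_comm]; exact ENNReal.mul_div_le
    have hT : ∀ G : MvPowerSeries (Option τ) K, wnorm ρ (divXPow k G) * r ^ k ≤ wnorm ρ G := by
      intro G
      have := wnorm_mul_wt_le ρ (f := G) (g := divXPow k G) (e := Finsupp.single none k)
        fun d => by rw [coeff_divXPow]
      simpa [hρ] using this
    set B := 2 * wnorm ρ (divXPow k F) with hB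
    have hFρ : wnorm ρ (divXPow k F) ≠ ∞ := by
      intro h
      have := hT F
      rw [h, ENNReal.top_mul hrk, top_le_iff] at this
      exact hFr (top_le_iff.1 (this ▸ wnorm_mono hρr F))
    have hBt : B ≠ ∞ := ENNReal.mul_ne_top (by simp) hFρ
    obtain ⟨Q, hQ, hfix⟩ := exists_fixedPoint (optWeight τ) {Q | wnorm ρ (Q ()) ≤ B} Φ (u₀ := 0)
      (by simp)
      (fun Q hQ => by
        have h1 : wnorm ρ (divXPow k (Q () * s)) ≤ B / 2 := by
          have h2 : wnorm ρ (divXPow k (Q () * s)) * r ^ k ≤ B / 2 * r ^ k := by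
            calc _ ≤ wnorm ρ (Q () * s) := hT _
              _ ≤ wnorm ρ (Q ()) * wnorm ρ s := wnorm_mul_le _ _ _
              _ ≤ B * (r ^ k / 2) := mul_le_mul' hQ hsρ
              _ = _ := by rw [div_eq_mul_inv, div_eq_mul_inv]; ring
          exact (ENNReal.mul_le_mul_iff_left hrk hrk').1 h2
        have h3 : wnorm ρ (divXPow k F) = B / 2 := by
          rw [hB, mul_comm, ENNReal.mul_div_cancel_right (by simp) (by simp)]
        calc wnorm ρ (Φ Q ()) ≤ wnorm ρ (divXPow k F) + wnorm ρ (divXPow k (Q () * s)) :=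
              wnorm_sub_le _ _ _
          _ ≤ B / 2 + B / 2 := by rw [h3]; gcongr
          _ = B := ENNReal.add_halves B)
      (fun u _ v _ m h => hcon u v m h)
      (fun u hu => wnorm_le_of_forall_exists (optWeight τ) _ fun m => by
        obtain ⟨v, hv, h⟩ := hu m
        exact ⟨v (), hv, h ()⟩)
    have hQc : (Q ()).IsConvergent := isConvergent_of_wnorm hρ0 (ne_top_of_le_ne_top hBt hQ)
    obtain ⟨R, hR, hRc⟩ := finish Q hfix
    exact ⟨Q (), R, hR, fun h1 h2 => ⟨hQc, hRc h1 h2 hQc⟩⟩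
  · obtain ⟨Q, -, hfix⟩ := exists_fixedPoint (optWeight τ) Set.univ Φ (u₀ := 0) trivial
      (fun _ _ => trivial) (fun u _ v _ m h => hcon u v m h) (fun _ _ => trivial)
    obtain ⟨R, hR, -⟩ := finish Q hfix
    exact ⟨Q (), R, hR, fun h1 h2 => absurd ⟨h1, h2⟩ hc⟩

/-- Formal Weierstrass preparation. -/
theorem exists_weierstrass_preparation [Finite τ] {e : ℕ} {d : MvPowerSeries (Option τ) K}
    (h0 : ∀ j < e, coeff (Finsupp.single none j) d = 0) (he : coeff (Finsupp.single none e) d ≠ 0) :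
    ∃ (A : Fin e → MvPowerSeries τ K) (c : MvPowerSeries (Option τ) K),
      (∀ j, constantCoeff (A j) = 0) ∧ constantCoeff c ≠ 0 ∧
      X none ^ e + ∑ j : Fin e, X none ^ (j : ℕ) * incl (A j) = c * d := by
  -- Modulo the variables `τ`, `d` equals `v * X none ^ e` with `v` a unit, so `v⁻¹ * d` is an
  -- admissible divisor. Dividing `X none ^ e` by it yields the Weierstrass polynomial.
  set v := divXPow e d with hv
  have hcv : constantCoeff v ≠ 0 := by
    rw [← coeff_zero_eq_constantCoeff_apply, hv, coeff_divXPow, zero_add]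
    exact he
  have hvv : v⁻¹ * v = 1 := MvPowerSeries.inv_mul_cancel v hcv
  have hmem : v⁻¹ * d - X none ^ e ∈ wIdeal (optWeight τ) 1 := by
    have h1 : d - v * X none ^ e ∈ wIdeal (optWeight τ) 1 := by
      rw [mem_wIdeal_optWeight_one_iff]
      intro j
      by_cases hj : j < e
      · rw [map_sub, h0 j hj, X_pow_eq, coeff_mul_monomial, if_neg, sub_zero]
        intro h
        have := Finsupp.single_le_iff.1 h
        simp at this
        omega
      · obtain ⟨i, rfl⟩ := Nat.exists_eq_add_of_le' (not_lt.1 hj)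
        rw [map_sub, X_pow_eq, Finsupp.single_add, coeff_add_mul_monomial, hv, coeff_divXPow,
          mul_one, sub_self]
    have h2 : v⁻¹ * d - X none ^ e = v⁻¹ * (d - v * X none ^ e) := by
      rw [mul_sub, ← mul_assoc, hvv, one_mul]
    rw [h2]
    exact Ideal.mul_mem_left _ _ h1
  obtain ⟨Q, R, hQR, -⟩ := exists_weierstrass_division hmem (X none ^ e)
  -- Comparing coefficients modulo `τ` shows that the remainder vanishes at the origin and that `Q`
  -- is a unit.
  have h3 : (1 - Q) * X none ^ e - ∑ j : Fin e, X none ^ (j : ℕ) * incl (R j) ∈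
      wIdeal (optWeight τ) 1 := by
    have h4 : (1 - Q) * X none ^ e - ∑ j : Fin e, X none ^ (j : ℕ) * incl (R j) =
        Q * (v⁻¹ * d - X none ^ e) := by linear_combination hQR
    rw [h4]
    exact Ideal.mul_mem_left _ _ hmem
  rw [mem_wIdeal_optWeight_one_iff] at h3
  have hR0 : ∀ j, constantCoeff (R j) = 0 := by
    intro j
    have h5 := h3 j
    rw [map_sub, coeff_sum_X_pow_mul_incl, X_pow_eq, coeff_mul_monomial, if_neg, zero_sub,
      dif_pos (by simp), neg_eq_zero] at h5
    · have h6 : (Finsupp.single none (j : ℕ) : Option τ →₀ ℕ).some = 0 := by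
        ext i; simp
      rw [h6] at h5
      simpa using h5
    · intro h
      have := Finsupp.single_le_iff.1 h
      simp at this
      omega
  have hQ0 : constantCoeff Q = 1 := by
    have h5 := h3 e
    rw [map_sub, coeff_sum_X_pow_mul_incl, dif_neg (by simp), sub_zero, X_pow_eq,
      coeff_mul_monomial, if_pos le_rfl, tsub_self, mul_one, coeff_zero_eq_constantCoeff_apply,
      map_sub, map_one, sub_eq_zero] at h5
    exact h5.symm
  refine ⟨fun j => -R j, Q * v⁻¹, by simp [hR0], ?_, ?_⟩
  · rw [map_mul, hQ0, one_mul, constantCoeff_inv]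
    exact inv_ne_zero hcv
  · have : ∀ j, incl (-R j) = -incl (R j) := fun j => by rw [incl, map_neg]; rfl
    simp only [this, mul_neg, Finset.sum_neg_distrib]
    linear_combination hQR

end Weierstrass

end MvPowerSeries

namespace MvPowerSeries

/-! ### Solving a regular system with coefficients in one variable fewer -/

section Regular

variable {σ τ : Type*} {K : Type*} [NormedField K]

variable (σ K) in
/-- Artin approximation for power series in the variables `σ`: formal power series can be
approximated by convergent ones that satisfy all their convergent relations. -/
def Approximable : Prop :=
  ∀ (ι : Type) [Fintype ι] (ybar : ι → MvPowerSeries σ K), (∀ i, constantCoeff (ybar i) = 0) →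
    ∀ c : ℕ, ∃ y : ι → MvPowerSeries σ K, (∀ i, (y i).IsConvergent) ∧
      (∀ i, constantCoeff (y i) = 0) ∧
      (∀ f : MvPowerSeries (σ ⊕ ι) K, f.IsConvergent → subst (Sum.elim X ybar) f = 0 →
        subst (Sum.elim X y) f = 0) ∧
      ∀ i, y i - ybar i ∈ wIdeal (fun _ => 1) c

lemma incl_eq_subst (f : MvPowerSeries τ K) : incl f = subst (fun i => X (some i)) f :=
  rename_eq_subst ..

lemma incl_add (f g : MvPowerSeries τ K) : incl (f + g) = incl f + incl g := map_add _ _ _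

lemma incl_sub (f g : MvPowerSeries τ K) : incl (f - g) = incl f - incl g := map_sub _ _ _

lemma incl_zero : incl (0 : MvPowerSeries τ K) = 0 := map_zero _

@[simp] lemma constantCoeff_incl (f : MvPowerSeries τ K) :
    constantCoeff (incl f) = constantCoeff f := constantCoeff_rename ..

lemma incl_C (a : K) : incl (C a : MvPowerSeries τ K) = C a := rename_C ..

lemma incl_mem_wIdeal [Finite τ] {c : ℕ} {f : MvPowerSeries τ K}
    (hf : f ∈ wIdeal (fun _ => 1) c) : incl f ∈ wIdeal (fun _ => 1) c := by
  rw [incl_eq_subst]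
  exact subst_mem_wIdeal (by simp) hf

lemma IsConvergent.incl [Finite τ] {f : MvPowerSeries τ K} (hf : f.IsConvergent) :
    (incl f).IsConvergent := by
  rw [incl_eq_subst]
  exact hf.subst (fun _ => isConvergent_X _) (by simp)

lemma IsConvergent.pow {f : MvPowerSeries τ K} (hf : f.IsConvergent) (n : ℕ) :
    (f ^ n).IsConvergent := pow_mem (mem_convergent.2 hf) n

lemma isConvergent_sum {α : Type*} {s : Finset α} {f : α → MvPowerSeries τ K}
    (hf : ∀ i ∈ s, (f i).IsConvergent) : (∑ i ∈ s, f i).IsConvergent :=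
  mem_convergent.1 (sum_mem hf)

lemma sum_X_pow_mul_incl_mem {k : ℕ} {R : Fin k → MvPowerSeries τ K}
    (hR : ∀ j, constantCoeff (R j) = 0) :
    ∑ j : Fin k, X none ^ (j : ℕ) * incl (R j) ∈ wIdeal (optWeight τ) 1 := by
  rw [mem_wIdeal_optWeight_one_iff]
  intro j
  rw [coeff_sum_X_pow_mul_incl]
  split_ifs with h
  · rw [Finsupp.some_single_none]
    exact hR _
  · rfl

/-- Makes `X none ^ c * a ^ 2` an admissible divisor of degree `c + 2 * e`. -/
lemma X_pow_mul_sq_sub_mem {c e : ℕ} {a : MvPowerSeries (Option τ) K}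
    (ha : a - X none ^ e ∈ wIdeal (optWeight τ) 1) :
    X none ^ c * a ^ 2 - X none ^ (c + 2 * e) ∈ wIdeal (optWeight τ) 1 := by
  have : X none ^ c * a ^ 2 - X none ^ (c + 2 * e) =
      X none ^ c * (a + X none ^ e) * (a - X none ^ e) := by ring
  rw [this]
  exact Ideal.mul_mem_left _ _ ha

lemma X_pow_mem_wIdeal {i : τ} (c : ℕ) :
    (X i ^ c : MvPowerSeries τ K) ∈ wIdeal (fun _ => 1) c := by
  induction c with
  | zero => exact mem_wIdeal_zero _ _
  | succ c ih =>
    rw [pow_succ]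
    exact mul_mem_wIdeal ih (mem_wIdeal_one_iff.2 (constantCoeff_X i))

lemma ne_zero_of_sub_X_pow_mem {e : ℕ} {a : MvPowerSeries (Option τ) K}
    (ha : a - X none ^ e ∈ wIdeal (optWeight τ) 1) : a ≠ 0 := by
  classical
  rintro rfl
  have := mem_wIdeal_optWeight_one_iff.1 ha e
  simp [X_pow_eq] at this

/-- The square `a ^ 2` in the modulus is what Tougeron's theorem requires. The extra `X none ^ c`
removes the constant term of its error and keeps the correction in order at least `c`. -/
theorem exists_solution_of_regular {σ : Type} [Fintype σ] (hA : Approximable σ K) {ι ω : Type}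
    [Fintype ι] [Fintype ω] [DecidableEq ω] (ybar : ι → MvPowerSeries (Option σ) K)
    (hybar : ∀ i, constantCoeff (ybar i) = 0) (g : ω → MvPowerSeries (Option σ ⊕ ι) K) (κ : ω → ι)
    (hgc : ∀ k, (g k).IsConvergent) (hg : ∀ k, subst (Sum.elim X ybar) (g k) = 0) {e : ℕ}
    (h0 : ∀ j < e, coeff (Finsupp.single none j)
      (subst (Sum.elim X ybar) (jac g (Sum.inr ∘ κ)).det) = 0)
    (he : coeff (Finsupp.single none e)
      (subst (Sum.elim X ybar) (jac g (Sum.inr ∘ κ)).det) ≠ 0) {c : ℕ} (hc : c ≠ 0) :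
    ∃ y : ι → MvPowerSeries (Option σ) K, (∀ i, (y i).IsConvergent) ∧
      (∀ i, constantCoeff (y i) = 0) ∧ (∀ k, subst (Sum.elim X y) (g k) = 0) ∧
      ∀ i, y i - ybar i ∈ wIdeal (fun _ => 1) c := by
  classical
  have hpt : ∀ z : ι → MvPowerSeries (Option σ) K, (∀ i, constantCoeff (z i) = 0) →
      ∀ l, constantCoeff (Sum.elim X z l : MvPowerSeries (Option σ) K) = 0 := by
    rintro z hz (l | l) <;> simp [hz]
  set d := subst (Sum.elim X ybar) (jac g (Sum.inr ∘ κ)).det with hd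
  obtain ⟨A, c₀, hA0, hc₀, hprep⟩ := exists_weierstrass_preparation h0 he
  set a := X none ^ e + ∑ j : Fin e, X none ^ (j : ℕ) * incl (A j) with ha
  have hae : a - X none ^ e ∈ wIdeal (optWeight σ) 1 := by
    rw [ha, add_sub_cancel_left]
    exact sum_X_pow_mul_incl_mem hA0
  set k := c + 2 * e with hk
  have hp : X none ^ c * a ^ 2 - X none ^ k ∈ wIdeal (optWeight σ) 1 := X_pow_mul_sq_sub_mem hae
  choose q Y hqY _ using fun i => exists_weierstrass_division hp (ybar i)
  -- generic coefficients
  let U := Fin e ⊕ (ι × Fin k)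
  let ubar : U → MvPowerSeries σ K :=
    -- Substituted series must have no constant term; the constants removed here return as scalars
    -- in `Ygen`.
    Sum.elim A fun ij => Y ij.1 ij.2 - C (constantCoeff (Y ij.1 ij.2))
  have hubar : ∀ l, constantCoeff (ubar l) = 0 := by
    rintro (l | l)
    · exact hA0 l
    · simp [ubar]
  let Agen : MvPowerSeries (Option (σ ⊕ U)) K :=
    X none ^ e + ∑ j : Fin e, X none ^ (j : ℕ) * incl (X (Sum.inr (Sum.inl j)))
  have hAgen : Agen - X none ^ e ∈ wIdeal (optWeight (σ ⊕ U)) 1 := by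
    simp only [Agen, add_sub_cancel_left]
    exact sum_X_pow_mul_incl_mem (by simp)
  let Ygen : ι → MvPowerSeries (Option (σ ⊕ U)) K := fun i => ∑ j : Fin k, X none ^ (j : ℕ) *
    (C (constantCoeff (Y i j)) + incl (X (Sum.inr (Sum.inr (i, j)))))
  have hYc : ∀ i, constantCoeff (∑ j : Fin k, X none ^ (j : ℕ) * incl (Y i j)) = 0 := by
    intro i
    have h1 := congrArg constantCoeff (hqY i)
    rw [hybar, map_add, map_mul, map_mul, map_pow, constantCoeff_X, zero_pow hc] at h1
    simpa using h1.symm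
  have hYgen : ∀ i, constantCoeff (Ygen i) = 0 := by
    intro i
    have h1 := hYc i
    simp only [map_sum, map_mul, map_pow, constantCoeff_X, constantCoeff_incl] at h1
    simp only [Ygen, map_sum, map_mul, map_pow, map_add, constantCoeff_C, constantCoeff_incl,
      constantCoeff_X, add_zero]
    exact h1
  let G : Option σ ⊕ ι → MvPowerSeries (Option (σ ⊕ U)) K :=
    Sum.elim (fun o => X (o.map Sum.inl)) Ygen
  have hG0 : ∀ l, constantCoeff (G l) = 0 := by
    rintro (l | l)
    · simp [G]
    · exact hYgen l
  have hGs : HasSubst G := hasSubst_of_constantCoeff_zero hG0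
  have hGc : ∀ l, (G l).IsConvergent := by
    rintro (l | l)
    · exact isConvergent_X _
    · exact isConvergent_sum fun j _ => ((isConvergent_X _).pow _).mul
        ((isConvergent_C _).add (isConvergent_X _).incl)
  have hAgenc : Agen.IsConvergent := ((isConvergent_X _).pow _).add
    (isConvergent_sum fun j _ => ((isConvergent_X _).pow _).mul (isConvergent_X _).incl)
  have hjc : (jac g (Sum.inr ∘ κ)).det.IsConvergent :=
    isConvergent_det fun i j => (hgc i).pderiv _
  -- Division with indeterminate coefficients: where the convergent series `R` and `R'` vanish, the
  -- modulus divides `g` and `Agen` divides the minor.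
  choose Q R hQR hQRc using fun l => exists_weierstrass_division
    (X_pow_mul_sq_sub_mem (c := c) hAgen) (subst G (g l))
  obtain ⟨Q', R', hQR', hQRc'⟩ := exists_weierstrass_division hAgen
    (subst G (jac g (Sum.inr ∘ κ)).det)
  -- specialization of the generic coefficients
  let S : (U → MvPowerSeries σ K) → Option (σ ⊕ U) → MvPowerSeries (Option σ) K :=
    fun u o => o.elim (X none) (Sum.elim (fun s => X (some s)) fun l => incl (u l))
  have hS0 : ∀ u : U → MvPowerSeries σ K, (∀ l, constantCoeff (u l) = 0) →
      ∀ o, constantCoeff (S u o) = 0 := by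
    rintro u hu (_ | (o | o)) <;> simp [S, hu]
  have hSincl : ∀ u : U → MvPowerSeries σ K, (∀ l, constantCoeff (u l) = 0) →
      ∀ F : MvPowerSeries (σ ⊕ U) K, subst (S u) (incl F) = incl (subst (Sum.elim X u) F) := by
    intro u hu F
    have h1 : HasSubst (Sum.elim X u : σ ⊕ U → MvPowerSeries σ K) :=
      hasSubst_of_constantCoeff_zero (by rintro (l | l) <;> simp [hu])
    have h2 := hasSubst_of_constantCoeff_zero (hS0 u hu)
    have h3 : HasSubst (fun i : σ => (X (some i) : MvPowerSeries (Option σ) K)) :=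
      hasSubst_of_constantCoeff_zero (by simp)
    have h4 : HasSubst (fun i : σ ⊕ U => (X (some i) : MvPowerSeries (Option (σ ⊕ U)) K)) :=
      hasSubst_of_constantCoeff_zero (by simp)
    rw [incl_eq_subst, incl_eq_subst, subst_subst h4 h2, subst_subst h1 h3]
    congr 1
    funext l
    rw [subst_X h2]
    rcases l with l | l
    · simp [S, subst_X h3]
    · simp [S, incl_eq_subst]
  let au : (U → MvPowerSeries σ K) → MvPowerSeries (Option σ) K := fun u =>
    X none ^ e + ∑ j : Fin e, X none ^ (j : ℕ) * incl (u (Sum.inl j))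
  let ys : (U → MvPowerSeries σ K) → ι → MvPowerSeries (Option σ) K := fun u i =>
    ∑ j : Fin k, X none ^ (j : ℕ) * incl (C (constantCoeff (Y i j)) + u (Sum.inr (i, j)))
  have hSA : ∀ u : U → MvPowerSeries σ K, (∀ l, constantCoeff (u l) = 0) →
      subst (S u) Agen = au u := by
    intro u hu
    have h2 := hasSubst_of_constantCoeff_zero (hS0 u hu)
    have h1 : HasSubst (Sum.elim X u : σ ⊕ U → MvPowerSeries σ K) :=
      hasSubst_of_constantCoeff_zero (by rintro (l | l) <;> simp [hu])
    simp only [Agen, au, subst_add h2, subst_sum h2, subst_mul h2, subst_pow h2, subst_X h2,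
      hSincl u hu, subst_X h1, Sum.elim_inr]
    rfl
  have hSY : ∀ u : U → MvPowerSeries σ K, (∀ l, constantCoeff (u l) = 0) →
      ∀ i, subst (S u) (Ygen i) = ys u i := by
    intro u hu i
    have h2 := hasSubst_of_constantCoeff_zero (hS0 u hu)
    have h1 : HasSubst (Sum.elim X u : σ ⊕ U → MvPowerSeries σ K) :=
      hasSubst_of_constantCoeff_zero (by rintro (l | l) <;> simp [hu])
    simp only [Ygen, ys, subst_add h2, subst_sum h2, subst_mul h2, subst_pow h2, subst_X h2,
      hSincl u hu, subst_X h1, Sum.elim_inr, subst_C', incl_add, incl_C]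
    rfl
  have hys0 : ∀ u : U → MvPowerSeries σ K, (∀ l, constantCoeff (u l) = 0) →
      ∀ i, constantCoeff (ys u i) = 0 := by
    intro u hu i
    rw [← hSY u hu, constantCoeff_subst_zero (hS0 u hu), hYgen]
  have hSG : ∀ u : U → MvPowerSeries σ K, (∀ l, constantCoeff (u l) = 0) →
      ∀ F : MvPowerSeries (Option σ ⊕ ι) K,
        subst (S u) (subst G F) = subst (Sum.elim X (ys u)) F := by
    intro u hu F
    have h2 := hasSubst_of_constantCoeff_zero (hS0 u hu)
    rw [subst_subst hGs h2]
    congr 1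
    funext l
    rcases l with (_ | l) | l
    · simp [G, subst_X h2, S]
    · simp [G, subst_X h2, S]
    · exact hSY u hu l
  have hspec : ∀ u : U → MvPowerSeries σ K, (∀ l, constantCoeff (u l) = 0) →
      ∀ l, subst (Sum.elim X (ys u)) (g l) = subst (S u) (Q l) * (X none ^ c * au u ^ 2) +
        ∑ j : Fin k, X none ^ (j : ℕ) * incl (subst (Sum.elim X u) (R l j)) := by
    intro u hu l
    have h2 := hasSubst_of_constantCoeff_zero (hS0 u hu)
    have h1 := congrArg (subst (S u)) (hQR l)
    rw [hSG u hu] at h1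
    simp only [subst_add h2, subst_sum h2, subst_mul h2, subst_pow h2, subst_X h2,
      hSincl u hu, hSA u hu] at h1
    exact h1
  have hspec' : ∀ u : U → MvPowerSeries σ K, (∀ l, constantCoeff (u l) = 0) →
      subst (Sum.elim X (ys u)) (jac g (Sum.inr ∘ κ)).det = subst (S u) Q' * au u +
        ∑ j : Fin e, X none ^ (j : ℕ) * incl (subst (Sum.elim X u) (R' j)) := by
    intro u hu
    have h2 := hasSubst_of_constantCoeff_zero (hS0 u hu)
    have h1 := congrArg (subst (S u)) hQR'
    rw [hSG u hu] at h1
    simp only [subst_add h2, subst_sum h2, subst_mul h2, subst_pow h2, subst_X h2,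
      hSincl u hu, hSA u hu] at h1
    exact h1
  -- the formal specialization
  have hysbar : ∀ i, ys ubar i = ∑ j : Fin k, X none ^ (j : ℕ) * incl (Y i j) := by
    intro i
    refine Finset.sum_congr rfl fun j _ => ?_
    simp [ubar]
  have hdiff : ∀ F : MvPowerSeries (Option σ ⊕ ι) K, ∃ m, subst (Sum.elim X (ys ubar)) F =
      subst (Sum.elim X ybar) F + m * (X none ^ c * a ^ 2) := by
    intro F
    have h1 := subst_sub_subst_mem (hpt _ (hys0 ubar hubar)) (hpt _ hybar)
      (Ideal.span {X none ^ c * a ^ 2}) (by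
        rintro (l | l)
        · simp
        · simp only [Sum.elim_inr, hysbar]
          refine Ideal.mem_span_singleton'.2 ⟨-q l, ?_⟩
          linear_combination hqY l) F
    obtain ⟨m, hm⟩ := Ideal.mem_span_singleton'.1 h1
    exact ⟨m, by linear_combination -hm⟩
  -- `ys ubar` is congruent to `ybar`, where `g` vanishes; uniqueness of division kills the
  -- remainders.
  have hR : ∀ l j, subst (Sum.elim X ubar) (R l j) = 0 := by
    intro l
    obtain ⟨m, hm⟩ := hdiff (g l)
    rw [hg, zero_add, hspec ubar hubar] at hm
    exact (weierstrass_unique hp (Q := m - subst (S ubar) (Q l))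
      (R := fun j => subst (Sum.elim X ubar) (R l j)) (by
        rw [show au ubar = a from rfl] at hm
        linear_combination -hm)).2
  obtain ⟨m, hm⟩ := hdiff (jac g (Sum.inr ∘ κ)).det
  have hcc : c₀⁻¹ * c₀ = 1 := MvPowerSeries.inv_mul_cancel _ hc₀
  have hR' := weierstrass_unique hae (Q := c₀⁻¹ + m * (X none ^ c * a) - subst (S ubar) Q')
      (R := fun j => subst (Sum.elim X ubar) (R' j)) (by
        rw [hspec' ubar hubar, show au ubar = a from rfl, ← hd] at hm
        linear_combination -hm + c₀⁻¹ * hprep + d * hcc)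
  -- At `ubar` the minor is `a` times a unit. The constant term of the quotient does not depend on
  -- the specialization, so the quotient is also a unit at the convergent `u`.
  have hQ' : constantCoeff Q' ≠ 0 := by
    have h1 := congrArg constantCoeff hR'.1
    rw [map_sub, constantCoeff_subst_zero (hS0 ubar hubar), map_add, map_mul, map_mul, map_pow,
      constantCoeff_X, zero_pow hc, zero_mul, mul_zero, add_zero, map_zero, sub_eq_zero,
      constantCoeff_inv] at h1
    rw [← h1]
    exact inv_ne_zero hc₀
  -- convergent approximation of the coefficients
  obtain ⟨u, huc, hu0, hurel, huclose⟩ := hA U ubar hubar c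
  have hFc : ∀ l, (subst G (g l)).IsConvergent := fun l => (hgc l).subst hGc hG0
  have hpc : (X none ^ c * Agen ^ 2).IsConvergent := ((isConvergent_X _).pow _).mul (hAgenc.pow _)
  have hSc : ∀ o, (S u o).IsConvergent := by
    rintro (_ | (o | o))
    · exact isConvergent_X _
    · exact isConvergent_X _
    · exact (huc o).incl
  have hysc : ∀ i, (ys u i).IsConvergent := fun i => isConvergent_sum fun j _ =>
    ((isConvergent_X _).pow _).mul ((isConvergent_C _).add (huc _)).incl
  have hauc : (au u).IsConvergent := ((isConvergent_X _).pow _).add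
    (isConvergent_sum fun j _ => ((isConvergent_X _).pow _).mul (huc _).incl)
  have hgu : ∀ l, subst (Sum.elim X (ys u)) (g l) =
      au u ^ 2 * (X none ^ c * subst (S u) (Q l)) := by
    intro l
    rw [hspec u hu0, Finset.sum_eq_zero]
    · ring
    · intro j _
      rw [hurel _ ((hQRc l (hFc l) hpc).2 j) (hR l j), incl_zero, mul_zero]
  have hJu : (Matrix.of fun i j => subst (Sum.elim X (ys u))
      (pderiv K ((Sum.inr ∘ κ) j) (g i))).det = au u * subst (S u) Q' := by
    have h1 := subst_det (hasSubst_of_constantCoeff_zero (hpt _ (hys0 u hu0)))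
      (jac g (Sum.inr ∘ κ))
    rw [hspec' u hu0, Finset.sum_eq_zero, add_zero] at h1
    · rw [mul_comm]
      exact h1.symm
    · intro j _
      rw [hurel _ ((hQRc' (hjc.subst hGc hG0) hAgenc).2 j) (hR'.2 j), incl_zero, mul_zero]
  have hau0 : au u ≠ 0 := by
    refine ne_zero_of_sub_X_pow_mem (e := e) ?_
    simp only [au, add_sub_cancel_left]
    exact sum_X_pow_mul_incl_mem fun j => hu0 _
  obtain ⟨t, ht0, htg, hts, htc⟩ := exists_tougeron g (Sum.inr ∘ κ) (Sum.elim X (ys u))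
    (hpt _ (hys0 u hu0)) (au u) (subst (S u) Q') (fun l => X none ^ c * subst (S u) (Q l)) hJu hau0
    (by rw [constantCoeff_subst_zero (hS0 u hu0)]; exact hQ') hgu
    (fun l => by rw [map_mul, map_pow, constantCoeff_X, zero_pow hc, zero_mul])
  have htc' := htc hgc (by
    rintro (l | l)
    · exact isConvergent_X _
    · exact hysc l) hauc ((hQRc' (hjc.subst hGc hG0) hAgenc).1.subst hSc (hS0 u hu0))
    fun l => ((isConvergent_X _).pow _).mul ((hQRc l (hFc l) hpc).1.subst hSc (hS0 u hu0))
  have htX : ∀ j, t j ∈ wIdeal (fun _ => 1) c := by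
    intro j
    refine Ideal.span_le.2 ?_ (hts j)
    rintro _ ⟨l, rfl⟩
    exact Ideal.mul_mem_right _ _ (X_pow_mem_wIdeal c)
  refine ⟨fun i => ys u i + ∑ j, if κ j = i then au u * t j else 0, fun i => ?_, fun i => ?_,
    fun l => ?_, fun i => ?_⟩
  · refine (hysc i).add (isConvergent_sum fun j _ => ?_)
    split_ifs
    · exact hauc.mul (htc' j)
    · exact zero_mem (convergent _ K)
  · rw [map_add, hys0 u hu0, zero_add, map_sum]
    refine Finset.sum_eq_zero fun j _ => ?_
    split_ifs <;> simp [ht0]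
  · refine Eq.trans ?_ (htg l)
    congr 1
    funext o
    rcases o with o | o <;> simp
  · have h1 : ys u i + (∑ j, if κ j = i then au u * t j else 0) - ybar i =
        ∑ j : Fin k, X none ^ (j : ℕ) * incl (u (Sum.inr (i, j)) - ubar (Sum.inr (i, j))) +
        (∑ j, if κ j = i then au u * t j else 0) - q i * (X none ^ c * a ^ 2) := by
      have h2 : ys u i - ys ubar i =
          ∑ j : Fin k, X none ^ (j : ℕ) * incl (u (Sum.inr (i, j)) - ubar (Sum.inr (i, j))) := by
        rw [← Finset.sum_sub_distrib]
        refine Finset.sum_congr rfl fun j _ => ?_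
        rw [← mul_sub, ← incl_sub, add_sub_add_left_eq_sub]
      rw [← h2, hysbar]
      linear_combination -hqY i
    rw [h1]
    refine sub_mem (add_mem (sum_mem fun j _ => Ideal.mul_mem_left _ _
      (incl_mem_wIdeal (huclose _))) (sum_mem fun j _ => ?_))
      (Ideal.mul_mem_left _ _ (Ideal.mul_mem_right _ _ (X_pow_mem_wIdeal c)))
    split_ifs
    · exact Ideal.mul_mem_left _ _ (htX j)
    · exact zero_mem _

end Regular

end MvPowerSeries

namespace MvPowerSeries

/-! ### Changes of the variables `x` -/

section Coordinates

variable {σ τ ι ω : Type*} {K : Type*} [NormedField K]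

/-- Extension of a change of the variables `σ` by the identity on the variables `ι`. -/
noncomputable def extendPoint (ι : Type*) (θ : σ → MvPowerSeries τ K) :
    σ ⊕ ι → MvPowerSeries (τ ⊕ ι) K :=
  Sum.elim (fun i => subst (fun t => X (Sum.inl t)) (θ i)) fun j => X (Sum.inr j)

lemma constantCoeff_extendPoint [Finite τ] {θ : σ → MvPowerSeries τ K}
    (hθ : ∀ i, constantCoeff (θ i) = 0) (l : σ ⊕ ι) : constantCoeff (extendPoint ι θ l) = 0 := by
  rcases l with l | l
  · simp only [extendPoint, Sum.elim_inl]
    rw [constantCoeff_subst_zero (by simp), hθ]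
  · simp [extendPoint]

lemma isConvergent_extendPoint [Finite τ] {θ : σ → MvPowerSeries τ K}
    (hθ : ∀ i, (θ i).IsConvergent) (l : σ ⊕ ι) : (extendPoint ι θ l).IsConvergent := by
  rcases l with l | l
  · exact (hθ l).subst (fun _ => isConvergent_X _) (by simp)
  · exact isConvergent_X _

lemma subst_extendPoint [Finite σ] [Finite τ] [Finite ι] {θ : σ → MvPowerSeries τ K}
    (hθ : ∀ i, constantCoeff (θ i) = 0) {z : ι → MvPowerSeries τ K}
    (hz : ∀ j, constantCoeff (z j) = 0) (F : MvPowerSeries (σ ⊕ ι) K) :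
    subst (Sum.elim X z) (subst (extendPoint ι θ) F) = subst (Sum.elim θ z) F := by
  have h1 : HasSubst (Sum.elim X z : τ ⊕ ι → MvPowerSeries τ K) :=
    hasSubst_of_constantCoeff_zero (by rintro (l | l) <;> simp [hz])
  have h2 : HasSubst (fun t : τ => (X (Sum.inl t) : MvPowerSeries (τ ⊕ ι) K)) :=
    hasSubst_of_constantCoeff_zero (by simp)
  rw [subst_subst (hasSubst_of_constantCoeff_zero (constantCoeff_extendPoint hθ)) h1]
  congr 1
  funext l
  rcases l with l | l
  · simp only [extendPoint, Sum.elim_inl]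
    rw [subst_subst h2 h1]
    simp only [subst_X h1, Sum.elim_inl]
    exact congrFun subst_self _
  · simp [extendPoint, subst_X h1]

lemma subst_elim_subst {υ : Type*} [Finite σ] [Finite τ] [Finite ι] {a : σ → MvPowerSeries τ K}
    (ha : ∀ i, constantCoeff (a i) = 0) {z : ι → MvPowerSeries τ K}
    (hz : ∀ j, constantCoeff (z j) = 0) {b : τ → MvPowerSeries υ K}
    (hb : ∀ i, constantCoeff (b i) = 0) (F : MvPowerSeries (σ ⊕ ι) K) :
    subst b (subst (Sum.elim a z) F) =
      subst (Sum.elim (fun i => subst b (a i)) fun j => subst b (z j)) F := by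
  rw [subst_subst (hasSubst_of_constantCoeff_zero (by rintro (l | l) <;> simp [ha, hz]))
    (hasSubst_of_constantCoeff_zero hb)]
  congr 1
  funext l
  rcases l with l | l <;> rfl

/-- `θ` does not involve the variables `ι`, so their derivatives commute with the substitution. -/
lemma pderiv_inr_subst_extendPoint [Fintype σ] [Fintype τ] [Fintype ι] {θ : σ → MvPowerSeries τ K}
    (hθ : ∀ i, constantCoeff (θ i) = 0) (j : ι) (F : MvPowerSeries (σ ⊕ ι) K) :
    pderiv K (Sum.inr j) (subst (extendPoint ι θ) F) =
      subst (extendPoint ι θ) (pderiv K (Sum.inr j) F) := by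
  classical
  have h1 : ∀ i, pderiv K (Sum.inr j) (extendPoint ι θ (Sum.inl i)) = 0 := by
    intro i
    simp only [extendPoint, Sum.elim_inl]
    rw [derivation_subst (by simp)]
    exact Finset.sum_eq_zero fun t _ => by rw [pderiv_X_of_ne (by simp), mul_zero]
  have h2 : ∀ i, pderiv K (Sum.inr j) (extendPoint ι θ (Sum.inr i)) = if i = j then 1 else 0 := by
    intro i
    simp only [extendPoint, Sum.elim_inr]
    split_ifs with h
    · rw [h, pderiv_X_self]
    · exact pderiv_X_of_ne (by simpa using h)
  rw [derivation_subst (constantCoeff_extendPoint hθ), Fintype.sum_sum_type]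
  simp [h1, h2]

lemma subst_extendPoint_det_jac [Fintype σ] [Fintype τ] [Fintype ι] [Fintype ω] [DecidableEq ω]
    {θ : σ → MvPowerSeries τ K} (hθ : ∀ i, constantCoeff (θ i) = 0)
    (g : ω → MvPowerSeries (σ ⊕ ι) K) (κ : ω → ι) :
    subst (extendPoint ι θ) (jac g (Sum.inr ∘ κ)).det =
      (jac (fun k => subst (extendPoint ι θ) (g k)) (Sum.inr ∘ κ)).det := by
  rw [subst_det (hasSubst_of_constantCoeff_zero (constantCoeff_extendPoint hθ))]
  congr 1
  ext i j : 2
  simp only [jac, Matrix.map_apply, Matrix.of_apply, Function.comp_apply]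
  rw [pderiv_inr_subst_extendPoint hθ]

/-- The coefficients of the powers of the distinguished variable are read off on its axis. -/
lemma coeff_subst_axis [Finite τ] (F : MvPowerSeries (Option τ) K) (j : ℕ) :
    coeff (Finsupp.single () j) (subst (fun o : Option τ => o.elim (X ()) fun _ => 0) F :
      MvPowerSeries Unit K) = coeff (Finsupp.single none j) F := by
  classical
  have hs : HasSubst (fun o : Option τ => o.elim (X ()) fun _ => (0 : MvPowerSeries Unit K)) :=
    hasSubst_of_constantCoeff_zero (by rintro (_ | t) <;> simp)
  rw [coeff_subst hs, finsum_eq_single _ (Finsupp.single none j)]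
  · rw [Finsupp.prod_single_index (by simp)]
    simp [X_pow_eq]
  · intro d hd
    by_cases h : ∃ t : τ, d (some t) ≠ 0
    · obtain ⟨t, ht⟩ := h
      rw [Finsupp.prod, Finset.prod_eq_zero (Finsupp.mem_support_iff.2 ht) (by simp [ht])]
      simp
    · push Not at h
      have h1 : d = Finsupp.single none (d none) := by
        ext o
        rcases o with _ | t <;> simp [h]
      rw [h1, Finsupp.prod_single_index (by simp)]
      have h2 : j ≠ d none := by
        rintro rfl
        exact hd h1
      simp [X_pow_eq, coeff_monomial, h2]

end Coordinates

lemma X_ne_zero {σ R : Type*} [Semiring R] [Nontrivial R] (i : σ) :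
    (X i : MvPowerSeries σ R) ≠ 0 := by
  classical
  intro h
  have := congrArg (coeff (Finsupp.single i 1)) h
  simp at this

/-! ### The induction on the number of variables -/

section Induction

variable {K : Type*} [NormedField K] [CharZero K]

/-- Approximation of a formal solution of a convergent system with nonvanishing Jacobian minor. -/
theorem exists_solution_of_minor {n : ℕ} (hA : Approximable (Fin n) K) {ι ω : Type}
    [Fintype ι] [Fintype ω] [DecidableEq ω] (ybar : ι → MvPowerSeries (Fin (n + 1)) K)
    (hybar : ∀ i, constantCoeff (ybar i) = 0) (g : ω → MvPowerSeries (Fin (n + 1) ⊕ ι) K)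
    (κ : ω → ι) (hgc : ∀ k, (g k).IsConvergent) (hg : ∀ k, subst (Sum.elim X ybar) (g k) = 0)
    (hδ : subst (Sum.elim X ybar) (jac g (Sum.inr ∘ κ)).det ≠ 0) {c : ℕ} (hc : c ≠ 0) :
    ∃ y : ι → MvPowerSeries (Fin (n + 1)) K, (∀ i, (y i).IsConvergent) ∧
      (∀ i, constantCoeff (y i) = 0) ∧ (∀ k, subst (Sum.elim X y) (g k) = 0) ∧
      ∀ i, y i - ybar i ∈ wIdeal (fun _ => 1) c := by
  set δ := subst (Sum.elim X ybar) (jac g (Sum.inr ∘ κ)).det with hδdef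
  have hX : (X 0 : MvPowerSeries (Fin (n + 1)) K) ≠ 0 := X_ne_zero 0
  -- Including `X 0` forces `l 0 ≠ 0`, so that `l` and the remaining coordinate axes form a basis.
  obtain ⟨l, v, v', hv, hv', hlδ, hlX⟩ := exists_line hδ hX
  have hl0 : l 0 ≠ 0 := by
    intro h
    rw [subst_X (hasSubst_of_constantCoeff_zero (constantCoeff_line l)), line, h, map_zero,
      zero_mul] at hlX
    refine mul_ne_zero (pow_ne_zero _ (X_ne_zero ())) ?_ hlX.symm
    rintro rfl
    exact hv' (map_zero _)
  -- Linear coordinates in which the line of direction `l` is the axis of `none`; on that axis the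
  -- minor has its order `δ.order.toNat`, which is the required regularity.
  let θ : Fin (n + 1) → MvPowerSeries (Option (Fin n)) K :=
    Fin.cases (C (l 0) * X none) fun i => X (some i) + C (l i.succ) * X none
  let θ' : Option (Fin n) → MvPowerSeries (Fin (n + 1)) K := fun o =>
    o.elim (C (l 0)⁻¹ * X 0) fun i => X i.succ - C (l i.succ * (l 0)⁻¹) * X 0
  have hθ0 : ∀ i, constantCoeff (θ i) = 0 := by
    intro i
    cases i using Fin.cases <;> simp [θ]
  have hθ0' : ∀ o, constantCoeff (θ' o) = 0 := by
    rintro (_ | i) <;> simp [θ']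
  have hθc : ∀ i, (θ i).IsConvergent := by
    intro i
    cases i using Fin.cases with
    | zero => exact (isConvergent_C _).mul (isConvergent_X _)
    | succ i => exact (isConvergent_X _).add ((isConvergent_C _).mul (isConvergent_X _))
  have hθc' : ∀ o, (θ' o).IsConvergent := by
    rintro (_ | i)
    · exact (isConvergent_C _).mul (isConvergent_X _)
    · exact mem_convergent.1 (sub_mem (mem_convergent.2 (isConvergent_X _))
        (mem_convergent.2 ((isConvergent_C _).mul (isConvergent_X _))))
  have hs := hasSubst_of_constantCoeff_zero hθ0
  have hs' := hasSubst_of_constantCoeff_zero hθ0'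
  have hn : θ' none = C (l 0)⁻¹ * X 0 := rfl
  have hsome : ∀ i, θ' (some i) = X i.succ - C (l i.succ * (l 0)⁻¹) * X 0 := fun _ => rfl
  have hinv : ∀ i, subst θ' (θ i) = X i := by
    intro i
    cases i using Fin.cases with
    | zero =>
      simp only [θ, Fin.cases_zero, subst_mul hs', subst_C', subst_X hs', hn]
      rw [← mul_assoc, ← map_mul, mul_inv_cancel₀ hl0, map_one, one_mul]
    | succ i =>
      simp only [θ, Fin.cases_succ, subst_add hs', subst_mul hs', subst_C', subst_X hs', hn,
        hsome, map_mul]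
      ring
  have hinv' : ∀ F : MvPowerSeries (Fin (n + 1)) K, subst θ' (subst θ F) = F := by
    intro F
    rw [subst_subst hs hs']
    simp only [hinv]
    exact congrFun subst_self F
  let zbar : ι → MvPowerSeries (Option (Fin n)) K := fun i => subst θ (ybar i)
  have hzbar : ∀ i, constantCoeff (zbar i) = 0 := fun i => by
    rw [constantCoeff_subst_zero hθ0, hybar]
  have hbar : ∀ F : MvPowerSeries (Fin (n + 1) ⊕ ι) K,
      subst (Sum.elim X zbar) (subst (extendPoint ι θ) F) =
        subst θ (subst (Sum.elim X ybar) F) := by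
    intro F
    rw [subst_extendPoint hθ0 hzbar, subst_elim_subst (by simp) hybar hθ0]
    simp only [subst_X hs]
    rfl
  have hcoeff : ∀ j, coeff (Finsupp.single none j) (subst (Sum.elim X zbar)
      (jac (fun k => subst (extendPoint ι θ) (g k)) (Sum.inr ∘ κ)).det) =
      coeff (Finsupp.single () j) (X () ^ δ.order.toNat * v) := by
    intro j
    rw [← subst_extendPoint_det_jac hθ0, hbar, ← coeff_subst_axis, subst_subst hs
      (hasSubst_of_constantCoeff_zero (by rintro (_ | t) <;> simp)), ← hlδ]
    congr 3
    have hax : HasSubst (fun o : Option (Fin n) => o.elim (X ())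
        fun _ => (0 : MvPowerSeries Unit K)) :=
      hasSubst_of_constantCoeff_zero (by rintro (_ | t) <;> simp)
    funext i
    cases i using Fin.cases with
    | zero => simp [θ, line, subst_mul hax, subst_X hax]
    | succ i => simp [θ, line, subst_add hax, subst_mul hax, subst_X hax]
  obtain ⟨z, hzc, hz0, hzg, hzclose⟩ := exists_solution_of_regular hA zbar hzbar
    (fun k => subst (extendPoint ι θ) (g k)) κ
    (fun k => (hgc k).subst (isConvergent_extendPoint hθc) (constantCoeff_extendPoint hθ0))
    (fun k => by rw [hbar, hg, subst_zero' hs]) (e := δ.order.toNat)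
    (fun j hj => by
      classical
      rw [hcoeff, X_pow_eq, coeff_monomial_mul, if_neg (by simpa using hj)])
    (by
      classical
      rw [hcoeff, X_pow_eq, coeff_monomial_mul, if_pos le_rfl]
      simpa using hv) hc
  refine ⟨fun i => subst θ' (z i), fun i => (hzc i).subst hθc' hθ0', fun i => ?_, fun k => ?_,
    fun i => ?_⟩
  · rw [constantCoeff_subst_zero hθ0', hz0]
  · have h1 := hzg k
    rw [subst_extendPoint hθ0 hz0] at h1
    have h2 := congrArg (subst θ') h1
    rw [subst_elim_subst hθ0 hz0 hθ0', subst_zero' hs'] at h2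
    simpa only [hinv] using h2
  · have h1 := subst_mem_wIdeal hθ0' (hzclose i)
    rw [sub_eq_add_neg, subst_add hs', ← neg_one_mul, subst_mul hs'] at h1
    have h2 : subst θ' (-1 : MvPowerSeries (Option (Fin n)) K) = -1 := by
      rw [← coe_substAlgHom hs', map_neg, map_one]
    rw [h2, hinv', neg_one_mul, ← sub_eq_add_neg] at h1
    exact h1

variable (K) in
theorem approximable_fin (n : ℕ) : Approximable (Fin n) K := by
  induction n with
  | zero =>
    intro ι _ ybar hybar c
    have h0 : ∀ i, ybar i = 0 := by
      intro i
      ext d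
      rw [Subsingleton.elim d 0, coeff_zero_eq_constantCoeff_apply, hybar, map_zero]
    refine ⟨ybar, fun i => ?_, hybar, fun _ _ h => h, fun i => ?_⟩
    · rw [h0]
      exact zero_mem (convergent _ K)
    · rw [sub_self]
      exact zero_mem _
  | succ n ih =>
    intro ι _ ybar hybar c
    obtain ⟨ω, _, _, g, κ, hgc, hg, hδ, hmax⟩ := exists_maximal_minor ybar hybar
    obtain ⟨y, hyc, hy0, hyg, hyclose⟩ := exists_solution_of_minor ih ybar hybar g κ hgc hg hδ
      -- This precision serves both the requested order `c` and the closeness demanded by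
      -- `subst_eq_zero_of_close`.
      (c := c + (2 * (subst (Sum.elim X ybar) (jac g (Sum.inr ∘ κ)).det).order.toNat + 1))
      (by omega)
    exact ⟨y, hyc, hy0, subst_eq_zero_of_close ybar hybar g κ hgc hg hδ hmax y hy0
      (fun i => wIdeal_anti _ (by omega) (hyclose i)) hyg,
      fun i => wIdeal_anti _ (by omega) (hyclose i)⟩

end Induction

/-! ### Order filtration and powers of the maximal ideal -/

section MaximalIdeal

variable {σ : Type*} {K : Type*} [NormedField K]

lemma X_mem_maximalIdeal (i : σ) : X i ∈ IsLocalRing.maximalIdeal (MvPowerSeries σ K) := by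
  rw [IsLocalRing.mem_maximalIdeal, mem_nonunits_iff, isUnit_iff_constantCoeff]
  simp

lemma monomial_mem_maximalIdeal_pow (d : σ →₀ ℕ) (a : K) :
    monomial d a ∈ IsLocalRing.maximalIdeal (MvPowerSeries σ K) ^ d.degree := by
  have h : monomial d a = C a * monomial d 1 := by
    rw [← smul_eq_C_mul, ← map_smul, smul_eq_mul, mul_one]
  rw [h, monomial_one_eq, Finsupp.degree_apply, ← Finset.prod_pow_eq_pow_sum]
  exact Ideal.mul_mem_left _ _ (Ideal.prod_mem_prod fun i _ =>
    Ideal.pow_mem_pow (X_mem_maximalIdeal i) _)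

lemma maximalIdeal_pow_le (c : ℕ) :
    IsLocalRing.maximalIdeal (MvPowerSeries σ K) ^ c ≤ wIdeal (fun _ => 1) c := by
  induction c with
  | zero => exact fun _ _ => mem_wIdeal_zero _ _
  | succ c ih =>
    rw [pow_succ, Ideal.mul_le]
    intro f hf g hg
    refine mul_mem_wIdeal (ih hf) (mem_wIdeal_one_iff.2 ?_)
    rwa [IsLocalRing.mem_maximalIdeal, mem_nonunits_iff, isUnit_iff_constantCoeff,
      isUnit_iff_ne_zero, not_not] at hg

lemma exists_polynomial_sub_mem_maximalIdeal_pow [Fintype σ] (c : ℕ) (f : MvPowerSeries σ K) :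
    ∃ p : MvPolynomial σ K,
      f - p ∈ IsLocalRing.maximalIdeal (MvPowerSeries σ K) ^ c := by
  induction c generalizing f with
  | zero => exact ⟨0, by simp⟩
  | succ c ih =>
    obtain ⟨a, g, rfl⟩ := exists_eq_C_add_sum f
    choose p hp using fun i => ih (g i)
    refine ⟨MvPolynomial.C a + ∑ i, MvPolynomial.X i * p i, ?_⟩
    have h1 : C a + ∑ i, X i * g i -
        ((MvPolynomial.C a + ∑ i, MvPolynomial.X i * p i : MvPolynomial σ K) :
          MvPowerSeries σ K) = ∑ i, X i * (g i - (p i : MvPowerSeries σ K)) := by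
      rw [← MvPolynomial.coeToMvPowerSeries.ringHom_apply, map_add, map_sum]
      simp [mul_sub]
    rw [h1, pow_succ']
    exact sum_mem fun i _ => Ideal.mul_mem_mul (X_mem_maximalIdeal i) (hp i)

/-- With finitely many variables, `f` is a polynomial modulo the `c`-th power, and a polynomial of
order at least `c` is a finite sum of monomials lying in that power. -/
theorem wIdeal_eq_maximalIdeal_pow [Finite σ] (c : ℕ) :
    wIdeal (fun _ => 1) c = IsLocalRing.maximalIdeal (MvPowerSeries σ K) ^ c := by
  cases nonempty_fintype σ
  refine le_antisymm (fun f hf => ?_) (maximalIdeal_pow_le c)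
  obtain ⟨p, hp⟩ := exists_polynomial_sub_mem_maximalIdeal_pow c f
  have h1 : (p : MvPowerSeries σ K) ∈ wIdeal (fun _ => 1) c := by
    have := sub_mem hf (maximalIdeal_pow_le c hp)
    rwa [sub_sub_cancel] at this
  have h2 : (p : MvPowerSeries σ K) ∈ IsLocalRing.maximalIdeal (MvPowerSeries σ K) ^ c := by
    rw [p.as_sum, ← MvPolynomial.coeToMvPowerSeries.ringHom_apply, map_sum]
    refine sum_mem fun d hd => ?_
    rw [MvPolynomial.coeToMvPowerSeries.ringHom_apply, MvPolynomial.coe_monomial]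
    refine Ideal.pow_le_pow_right ?_ (monomial_mem_maximalIdeal_pow d _)
    by_contra hlt
    refine MvPolynomial.mem_support_iff.1 hd ?_
    rw [← MvPolynomial.coeff_coe]
    exact mem_wIdeal_iff.1 h1 d (by rw [weight_one_eq_degree]; omega)
  simpa using add_mem hp h2

end MaximalIdeal

end MvPowerSeries

theorem mainTheorem2 {K : Type*} [NontriviallyNormedField K] [CharZero K] (m n N : ℕ)
    (f : Fin m → MvPowerSeries (Fin n ⊕ Fin N) K) (hf : ∀ i, (f i).IsConvergent)
    (ybar : Fin N → MvPowerSeries (Fin n) K)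
    (hybar0 : ∀ j, MvPowerSeries.constantCoeff (ybar j) = 0)
    (hybar : ∀ i, (f i).substRight ybar = 0) (c : ℕ) (hc : 0 < c) :
    ∃ y : Fin N → MvPowerSeries (Fin n) K,
      (∀ j, (y j).IsConvergent) ∧
      (∀ j, MvPowerSeries.constantCoeff (y j) = 0) ∧
      (∀ i, (f i).substRight y = 0) ∧
      ∀ j, y j - ybar j ∈ IsLocalRing.maximalIdeal (MvPowerSeries (Fin n) K) ^ c := by
  obtain ⟨y, hyc, hy0, hyf, hyclose⟩ :=
    MvPowerSeries.approximable_fin K n (Fin N) ybar hybar0 c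
  -- `substRight` unfolds to substitution at `Sum.elim X y`, so each `f i` is one of the convergent
  -- relations of `ybar`.
  refine ⟨y, hyc, hy0, fun i => hyf (f i) (hf i) (hybar i), fun j => ?_⟩
  rw [← MvPowerSeries.wIdeal_eq_maximalIdeal_pow]
  exact hyclose j
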